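/- Let $e>0$, $L>0$. Let $\mathcal F$ be the complex vector space with basis the vectors $\Omega_{\mathbf m,\mathbf n}=b^\dagger_{m_1}\cdots b^\dagger_{m_M}c^\dagger_{n_1}\cdots c^\dagger_{n_N}\Omega_0$ indexed by pairs of finite subsets $\mathbf m=\{m_1<\dots<m_M\}$, $\mathbf n=\{n_1<\dots<n_N\}$ of $\mathbb Z$, with this basis orthonormal and with the fermionic operators $b_k,b_k^\dagger,c_k,c_k^\dagger$ ($k\in\mathbb Z$; $\{b_k,b_{l}^\dagger\}=\{c_k,c_{l}^\dagger\}=\delta_{kl}$, all other anticommutators zero, $b_k\Omega_0=c_k\Omega_0=0$). Let $\mathcal F_0$ be the span of the basis vectors with $M=N$, $\mathcal H_0$ its completion, and $\mathcal K=L^2([0,\frac{2\pi}{L}];\mathcal H_0)$. Put $$Q^5=\sum_{n\ge0}b_n^\dagger b_n-\sum_{n<0}b_n^\dagger b_n-\sum_{n>0}c_n^\dagger c_n+\sum_{n\le0}c_n^\dagger c_n,\qquad Q^{5,reg}=Q^5-\tfrac{aL}{\pi}-1,$$ $$T=\tfrac{2\pi}{L}\sum_{m\ge1}\bigl(\varrho^R(m)\varrho^R(-m)+\varrho^L(-m)\varrho^L(m)\bigr),$$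 where, for $m\ge1$, $$\varrho^R(m)=-\sum_{k>m}c_k^\dagger c_{k-m}+\sum_{0<k\le m}b_{m-k}^\dagger c_k^\dagger+\sum_{k\ge0}b_{k+m}^\dagger b_k,\qquad \varrho^R(-m)=\varrho^R(m)^\dagger,$$ $$\varrho^L(m)=\sum_{k<-m}b_{k+m}^\dagger b_k+\sum_{-m\le k<0}c_{-k-m}b_k-\sum_{k\le0}c_k^\dagger c_{k-m},\qquad \varrho^L(-m)=\varrho^L(m)^\dagger.$$ Let $\Omega_P=b_0^\dagger\cdots b_{P-1}^\dagger c_{-(P-1)}^\dagger\cdots c_0^\dagger\Omega_0$ for $P\ge0$ and $\Omega_P=b_P^\dagger\cdots b_{-1}^\dagger c_1^\dagger\cdots c_{-P}^\dagger\Omega_0$ for $P<0$. Let $\Gamma$ be the unitary operator determined by $\Gamma\Omega_0=\Omega_{-1}$, $\Gamma b_k^\dagger\Gamma^{-1}=b_{k-1}^\dagger$ and $\Gamma c_k^\dagger\Gamma^{-1}=c_{k+1}^\dagger$ for $k\ne0$, $\Gamma b_0^\dagger\Gamma^{-1}=c_1$, $\Gamma c_0^\dagger\Gamma^{-1}=b_{-1}$.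 Let $\mathcal D$ be the space of smooth (in the norm of $\mathcal H_0$) functions $\Psi:\mathbb R\to\mathcal H_0$ with values in $\mathcal F_0$ and $\Psi(a+\frac{2\pi}{L})=\Gamma^{-1}\Psi(a)$ for all $a$, regarded as elements of $\mathcal K$ by restriction to $[0,\frac{2\pi}{L}]$, and let $$H_0=-\frac{e^2}{2L}\frac{d^2}{da^2}+\frac{\pi}{2L}(Q^{5,reg})^2+T,\qquad E_0=\frac{e}{2\sqrt\pi}.$$ (i) For every $\Psi\in\mathcal D$, $\langle\Psi,H_0\Psi\rangle=\int_0^{2\pi/L}\operatorname{Re}\langle\Psi(a),(H_0\Psi)(a)\rangle\,da$ is well defined in $(-\infty,\infty]$ and is at least $E_0\|\Psi\|_{\mathcal K}^2$. If moreover $H_0\Psi\in\mathcal K$, then $\langle\Psi,H_0\Psi\rangle_{\mathcal K}$ is real and $\ge E_0\|\Psi\|_{\mathcal K}^2$; that is, $H_0\ge E_0$ on $\mathcal D$. (ii) Let $$f(x)=\frac{L^{1/4}}{\pi^{3/8}e^{1/4}}\exp\Bigl(-\frac{Lx^2}{2\sqrt\pi\,e}\Bigr),\qquad \Psi_0(a)=\sum_{P\in\mathbb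 Z}f\bigl(a-\tfrac{2\pi}{L}(P-\tfrac12)\bigr)\Omega_P .$$ (In the first formula $e$ is the coupling constant.) The series converges in $\mathcal H_0$ for every $a\in\mathbb R$; $\Psi_0$ is twice continuously differentiable, satisfies $\Psi_0(a+\frac{2\pi}{L})=\Gamma^{-1}\Psi_0(a)$ and $\Psi_0'(a+\frac{2\pi}{L})=\Gamma^{-1}\Psi_0'(a)$ for all $a$, and $\|\Psi_0\|_{\mathcal K}=1$. The bound is attained at $\Psi_0$: one has $H_0\Psi_0=E_0\Psi_0$, both pointwise in $a$ (with $(Q^{5,reg})^2$ and $T$ applied termwise to the series) and in the sense that $\Psi_0$ lies in the domain of the closure of the operator $H_0$ on $\{\Psi\in\mathcal D:H_0\Psi\in\mathcal K\}$, which maps it to $E_0\Psi_0$. -/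

import Mathlib

noncomputable section

open MeasureTheory
open scoped ContDiff

namespace Schwinger

/-- An occupation pattern `(m, n)`: `m` is the finite set of modes occupied by fermions and `n` the
finite set of modes occupied by anti-fermions. -/
abbrev Config : Type := Finset ℤ × Finset ℤ

/-- Finite linear combinations of the vectors
`Ω_{m,n} = b†_{m₁} ⋯ b†_{m_M} c†_{n₁} ⋯ c†_{n_N} Ω₀`, `m₁ < ⋯ < m_M`, `n₁ < ⋯ < n_N`
(all charges). -/
abbrev AlgFock : Type := Config →₀ ℂ

/-- Fermionic Fock space (all charges), with orthonormal basis the `Ω_{m,n}`. -/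
abbrev Fock : Type := lp (fun _ : Config => ℂ) 2

/-- The vector `Ω_{m,n}`, `s = (m, n)`. -/
def basisVec (s : Config) : AlgFock := Finsupp.single s 1

/-- The inclusion of the finite particle vectors in Fock space. -/
def toFock : AlgFock →ₗ[ℂ] Fock :=
  Finsupp.linearCombination ℂ (fun s : Config => (lp.single 2 s (1 : ℂ) : Fock))

/-! ### Creation and annihilation operators -/

/-- `b†_k` -/
def bCreate (k : ℤ) : AlgFock →ₗ[ℂ] AlgFock :=
  Finsupp.linearCombination ℂ fun s : Config =>
    if k ∈ s.1 then 0
    else ((-1 : ℂ) ^ (s.1.filter (· < k)).card) • basisVec (insert k s.1, s.2)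

/-- `b_k` -/
def bAnn (k : ℤ) : AlgFock →ₗ[ℂ] AlgFock :=
  Finsupp.linearCombination ℂ fun s : Config =>
    if k ∈ s.1 then ((-1 : ℂ) ^ (s.1.filter (· < k)).card) • basisVec (s.1.erase k, s.2)
    else 0

/-- `c†_k` -/
def cCreate (k : ℤ) : AlgFock →ₗ[ℂ] AlgFock :=
  Finsupp.linearCombination ℂ fun s : Config =>
    if k ∈ s.2 then 0
    else ((-1 : ℂ) ^ (s.1.card + (s.2.filter (· < k)).card)) • basisVec (s.1, insert k s.2)

/-- `c_k` -/
def cAnn (k : ℤ) : AlgFock →ₗ[ℂ] AlgFock :=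
  Finsupp.linearCombination ℂ fun s : Config =>
    if k ∈ s.2 then
      ((-1 : ℂ) ^ (s.1.card + (s.2.filter (· < k)).card)) • basisVec (s.1, s.2.erase k)
    else 0

/-- `𝓕₀`: the finite particle vectors with equal numbers of fermions and anti-fermions. -/
def zeroCharge : Submodule ℂ AlgFock :=
  Finsupp.supported ℂ ℂ {s : Config | s.1.card = s.2.card}

/-- `𝓗₀`: the completion of `𝓕₀`, as a closed subspace of Fock space. -/
def zeroChargeFock : Submodule ℂ Fock := (zeroCharge.map toFock).topologicalClosure

/-- The unexcited states: `Ω_P = b†_0 ⋯ b†_{P-1} c†_{-(P-1)} ⋯ c†_0 Ω₀` for `P ≥ 0` and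
`Ω_P = b†_P ⋯ b†_{-1} c†_1 ⋯ c†_{-P} Ω₀` for `P < 0`. -/
def unexcited (P : ℤ) : AlgFock :=
  if 0 ≤ P then basisVec (Finset.Ico 0 P, Finset.Ioc (-P) 0)
  else basisVec (Finset.Ico P 0, Finset.Ioc 0 (-P))

/-! ### Axial charge, density operators and the operator `T`

Each operator is given on the basis vectors, where all the sums have finitely many non-zero terms,
and is extended linearly. -/

/-- The axial charge
`Q⁵ = ∑_{n≥0} b†_n b_n - ∑_{n<0} b†_n b_n - ∑_{n>0} c†_n c_n + ∑_{n≤0} c†_n c_n`. -/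
def axialCharge : AlgFock →ₗ[ℂ] AlgFock :=
  Finsupp.linearCombination ℂ fun s : Config =>
    (∑ᶠ (n : ℤ) (_ : 0 ≤ n), bCreate n (bAnn n (basisVec s)))
      - (∑ᶠ (n : ℤ) (_ : n < 0), bCreate n (bAnn n (basisVec s)))
      - (∑ᶠ (n : ℤ) (_ : 0 < n), cCreate n (cAnn n (basisVec s)))
      + (∑ᶠ (n : ℤ) (_ : n ≤ 0), cCreate n (cAnn n (basisVec s)))

/-- The regularized axial charge `Q^{5,reg} = Q⁵ - aL/π - 1` at the value `a` of the potential. -/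
def axialChargeReg (L a : ℝ) : AlgFock →ₗ[ℂ] AlgFock :=
  axialCharge - ((a * L / Real.pi + 1 : ℝ) : ℂ) • LinearMap.id

/-- `ϱ^R(m)`, for `m ≥ 1` -/
def rhoRPlus (m : ℤ) : AlgFock →ₗ[ℂ] AlgFock :=
  Finsupp.linearCombination ℂ fun s : Config =>
    -(∑ᶠ (k : ℤ) (_ : m < k), cCreate k (cAnn (k - m) (basisVec s)))
      + (∑ᶠ (k : ℤ) (_ : 0 < k ∧ k ≤ m), bCreate (-k + m) (cCreate k (basisVec s)))
      + (∑ᶠ (k : ℤ) (_ : 0 ≤ k), bCreate (k + m) (bAnn k (basisVec s)))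

/-- `ϱ^R(-m)`, for `m ≥ 1` -/
def rhoRMinus (m : ℤ) : AlgFock →ₗ[ℂ] AlgFock :=
  Finsupp.linearCombination ℂ fun s : Config =>
    -(∑ᶠ (k : ℤ) (_ : m < k), cCreate (k - m) (cAnn k (basisVec s)))
      + (∑ᶠ (k : ℤ) (_ : 0 < k ∧ k ≤ m), cAnn k (bAnn (-k + m) (basisVec s)))
      + (∑ᶠ (k : ℤ) (_ : 0 ≤ k), bCreate k (bAnn (k + m) (basisVec s)))

/-- `ϱ^L(m)`, for `m ≥ 1` -/
def rhoLPlus (m : ℤ) : AlgFock →ₗ[ℂ] AlgFock :=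
  Finsupp.linearCombination ℂ fun s : Config =>
    (∑ᶠ (k : ℤ) (_ : k < -m), bCreate (k + m) (bAnn k (basisVec s)))
      + (∑ᶠ (k : ℤ) (_ : -m ≤ k ∧ k < 0), cAnn (-k - m) (bAnn k (basisVec s)))
      - (∑ᶠ (k : ℤ) (_ : k ≤ 0), cCreate k (cAnn (k - m) (basisVec s)))

/-- `ϱ^L(-m)`, for `m ≥ 1` -/
def rhoLMinus (m : ℤ) : AlgFock →ₗ[ℂ] AlgFock :=
  Finsupp.linearCombination ℂ fun s : Config =>
    (∑ᶠ (k : ℤ) (_ : k < -m), bCreate k (bAnn (k + m) (basisVec s)))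
      + (∑ᶠ (k : ℤ) (_ : -m ≤ k ∧ k < 0), bCreate k (cCreate (-k - m) (basisVec s)))
      - (∑ᶠ (k : ℤ) (_ : k ≤ 0), cCreate (k - m) (cAnn k (basisVec s)))

/-- `T = (2π/L) ∑_{m ≥ 1} (ϱ^R(m) ϱ^R(-m) + ϱ^L(-m) ϱ^L(m))`. -/
def kineticT (L : ℝ) : AlgFock →ₗ[ℂ] AlgFock :=
  Finsupp.linearCombination ℂ fun s : Config =>
    ((2 * Real.pi / L : ℝ) : ℂ) • ∑ᶠ (m : ℤ) (_ : 1 ≤ m),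
      (rhoRPlus m (rhoRMinus m (basisVec s)) + rhoLMinus m (rhoLPlus m (basisVec s)))

/-- `(π/2L) (Q^{5,reg})² + T` at the value `a` of the potential. -/
def potentialPart (L a : ℝ) : AlgFock →ₗ[ℂ] AlgFock :=
  ((Real.pi / (2 * L) : ℝ) : ℂ) • (axialChargeReg L a ∘ₗ axialChargeReg L a) + kineticT L

/-! ### The large gauge transformation `Γ` -/

theorem mem_image_sub_one (S : Finset ℤ) (x : ℤ) : x ∈ S.image (· - 1) ↔ x + 1 ∈ S := by
  simp only [Finset.mem_image]
  exact ⟨fun ⟨y, hy, h⟩ => by rwa [← h, sub_add_cancel], fun h => ⟨x + 1, h, by ring⟩⟩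

theorem mem_image_add_one (S : Finset ℤ) (x : ℤ) : x ∈ S.image (· + 1) ↔ x - 1 ∈ S := by
  simp only [Finset.mem_image]
  exact ⟨fun ⟨y, hy, h⟩ => by rwa [← h, add_sub_cancel_right], fun h => ⟨x - 1, h, by ring⟩⟩

theorem mem_ite_singleton (p : Prop) [Decidable p] (x y : ℤ) :
    (x ∈ if p then (∅ : Finset ℤ) else {y}) ↔ ¬ p ∧ x = y := by
  split_ifs with h <;> simp [h]

/-- The action of `Γ` on occupation patterns. -/
def gaugePerm : Equiv.Perm Config where
  toFun s :=
    ((s.1.erase 0).image (· - 1) ∪ (if 0 ∈ s.2 then ∅ else {-1}),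
      (s.2.erase 0).image (· + 1) ∪ (if 0 ∈ s.1 then ∅ else {1}))
  invFun s :=
    ((s.1.erase (-1)).image (· + 1) ∪ (if 1 ∈ s.2 then ∅ else {0}),
      (s.2.erase 1).image (· - 1) ∪ (if -1 ∈ s.1 then ∅ else {0}))
  left_inv s := by
    ext x <;> simp only [Finset.mem_union, mem_image_sub_one, mem_image_add_one, Finset.mem_erase,
      mem_ite_singleton, sub_add_cancel, add_sub_cancel_right] <;> grind
  right_inv s := by
    ext x <;> simp only [Finset.mem_union, mem_image_sub_one, mem_image_add_one, Finset.mem_erase,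
      mem_ite_singleton, sub_add_cancel, add_sub_cancel_right] <;> grind

/-- The sign in `Γ Ω_{m,n} = ± Ω_{m',n'}`; it is the one forced by `Γ Ω₀ = Ω_{-1}` and the relations
`Γ b†_k Γ⁻¹ = b†_{k-1}` (`k ≠ 0`), `Γ b†_0 Γ⁻¹ = c_1`, `Γ c†_k Γ⁻¹ = c†_{k+1}` (`k ≠ 0`),
`Γ c†_0 Γ⁻¹ = b_{-1}`; see `gauge_vacuum`, `gauge_bCreate`, `gauge_cCreate` below. -/
def gaugeSign (s : Config) : ℂ :=
  if (0 ∈ s.1 ↔ 0 ∈ s.2) then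
    (-1) ^ ((s.1.filter (0 < ·)).card + (s.2.filter (· < 0)).card)
  else if 0 ∈ s.1 then -1 else 1

theorem gaugeSign_mul_self (s : Config) : gaugeSign s * gaugeSign s = 1 := by
  unfold gaugeSign
  split_ifs
  · rw [← mul_pow]; simp
  · simp
  · simp

theorem norm_gaugeSign (s : Config) : ‖gaugeSign s‖ = 1 := by
  unfold gaugeSign
  split_ifs <;> simp

theorem memℓp_signed (σ : Equiv.Perm Config) (ε : Config → ℂ) (hε : ∀ s, ‖ε s‖ = 1) (ψ : Fock) :
    Memℓp (fun s : Config => ε s * ψ (σ s)) 2 := by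
  have h := (memℓp_gen_iff (by simp)).1 (lp.memℓp ψ)
  refine (memℓp_gen_iff (by simp)).2 ?_
  simpa [hε, Function.comp_def] using (σ.summable_iff.2 h)

/-- The unitary operator `Γ` on Fock space: `Γ Ω_s = gaugeSign s • Ω_{gaugePerm s}`. -/
def gauge : Fock ≃ₗᵢ[ℂ] Fock where
  toFun ψ := ⟨fun s => gaugeSign (gaugePerm.symm s) * ψ (gaugePerm.symm s),
    memℓp_signed gaugePerm.symm _ (fun _ => norm_gaugeSign _) ψ⟩
  invFun ψ := ⟨fun s => gaugeSign s * ψ (gaugePerm s),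
    memℓp_signed gaugePerm _ norm_gaugeSign ψ⟩
  map_add' x y := by ext s; simp only [lp.coeFn_add, Pi.add_apply, mul_add]
  map_smul' c x := by
    ext s; simp only [lp.coeFn_smul, Pi.smul_apply, smul_eq_mul, mul_left_comm]; rfl
  left_inv ψ := by ext s; simp [← mul_assoc, gaugeSign_mul_self]
  right_inv ψ := by ext s; simp [← mul_assoc, gaugeSign_mul_self]
  norm_map' ψ := by
    rw [lp.norm_eq_tsum_rpow (by simp), lp.norm_eq_tsum_rpow (by simp)]
    congr 1
    simp only [LinearEquiv.coe_mk, LinearMap.coe_mk, AddHom.coe_mk, norm_mul, norm_gaugeSign,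
      one_mul]
    exact gaugePerm.symm.tsum_eq (fun s => ‖ψ s‖ ^ (2 : ENNReal).toReal)

/-- `Γ` on finite particle vectors. -/
def gaugeAlg : AlgFock →ₗ[ℂ] AlgFock :=
  Finsupp.linearCombination ℂ fun s : Config => gaugeSign s • basisVec (gaugePerm s)

theorem gauge_toFock (x : AlgFock) : gauge (toFock x) = toFock (gaugeAlg x) := by
  have h : gauge.toLinearEquiv.toLinearMap ∘ₗ toFock = toFock ∘ₗ gaugeAlg := by
    refine Finsupp.lhom_ext' fun s => LinearMap.ext_ring ?_
    ext t
    by_cases hst : gaugePerm.symm t = s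
    · subst hst
      simp [gauge, toFock, gaugeAlg, basisVec, lp.single_apply]
    · have hst' : t ≠ gaugePerm s := fun h => hst (by simp [h])
      simp [gauge, toFock, gaugeAlg, basisVec, lp.single_apply, hst, hst']
  exact LinearMap.congr_fun h x

/-- `Γ Ω₀ = Ω_{-1}` -/
theorem gauge_vacuum : gaugeAlg (unexcited 0) = unexcited (-1) := by
  have h : gaugePerm ((∅ : Finset ℤ), (∅ : Finset ℤ)) = ({-1}, {1}) := by
    simp [gaugePerm]
  have h1 : Finset.Ico (-1 : ℤ) 0 = {-1} := by decide
  have h2 : Finset.Ioc (0 : ℤ) 1 = {1} := by decide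
  simp [unexcited, gaugeAlg, basisVec, h, h1, h2, gaugeSign]

theorem card_filter_shift (S : Finset ℤ) (d : ℤ) (p : Prop) [Decidable p] (r : ℤ → Prop)
    [DecidablePred r] :
    (((S.erase 0).image (· + d) ∪ (if p then ∅ else {d})).filter r).card
        + (if 0 ∈ S ∧ r d then 1 else 0)
      = (S.filter (fun x => r (x + d))).card + (if ¬ p ∧ r d then 1 else 0) := by
  rw [Finset.filter_union, Finset.card_union_of_disjoint, Finset.filter_image,
    Finset.card_image_of_injective _ (add_left_injective d)]
  · have h1 : (S.erase 0).filter (fun x => r (x + d)) = (S.filter (fun x => r (x + d))).erase 0 := by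
      ext x; simp [and_assoc]
    have h2 : ((if p then (∅ : Finset ℤ) else {d}).filter r).card
        = if ¬ p ∧ r d then 1 else 0 := by
      by_cases hp : p <;> by_cases hr : r d <;> simp [hp, hr, Finset.filter_singleton]
    rw [h1, h2, Finset.card_erase_eq_ite]
    by_cases h0 : 0 ∈ S ∧ r d
    · have h3 : 0 ∈ S.filter (fun x => r (x + d)) := by simpa using h0
      have := Finset.card_pos.2 ⟨_, h3⟩
      simp only [h3, h0, if_true]; simp; omega
    · have h3 : 0 ∉ S.filter (fun x => r (x + d)) := by simpa using h0
      simp only [h3, h0, if_false]; omega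
  · rw [Finset.disjoint_left]
    intro x hx hx'
    simp only [Finset.mem_filter, Finset.mem_image, Finset.mem_erase] at hx hx'
    obtain ⟨⟨y, ⟨hy, -⟩, rfl⟩, -⟩ := hx
    have := hx'.1
    split_ifs at this <;> simp at this
    exact hy this

theorem card_gaugePerm_fst (s : Config) (j : ℤ) :
    ((gaugePerm s).1.filter (· < j)).card + (if 0 ∈ s.1 ∧ -1 < j then 1 else 0)
      = (s.1.filter (· < j + 1)).card + (if ¬ 0 ∈ s.2 ∧ -1 < j then 1 else 0) := by
  have h := card_filter_shift s.1 (-1) (0 ∈ s.2) (· < j)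
  have h2 : s.1.filter (fun x => x + -1 < j) = s.1.filter (· < j + 1) :=
    Finset.filter_congr fun x _ => by omega
  rw [h2] at h
  exact h

theorem card_gaugePerm_snd (s : Config) (j : ℤ) :
    ((gaugePerm s).2.filter (· < j)).card + (if 0 ∈ s.2 ∧ 1 < j then 1 else 0)
      = (s.2.filter (· < j - 1)).card + (if ¬ 0 ∈ s.1 ∧ 1 < j then 1 else 0) := by
  have h := card_filter_shift s.2 1 (0 ∈ s.1) (· < j)
  have h2 : s.2.filter (fun x => x + 1 < j) = s.2.filter (· < j - 1) :=
    Finset.filter_congr fun x _ => by omega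
  rw [h2] at h
  exact h

theorem card_gaugePerm_fst' (s : Config) :
    (gaugePerm s).1.card + (if 0 ∈ s.1 then 1 else 0)
      = s.1.card + (if ¬ 0 ∈ s.2 then 1 else 0) := by
  have h := card_filter_shift s.1 (-1) (0 ∈ s.2) (fun _ => True)
  simp only [Finset.filter_true, and_true] at h
  exact h

theorem card_split (S : Finset ℤ) :
    S.card = (S.filter (· < 0)).card + (if 0 ∈ S then 1 else 0) + (S.filter (0 < ·)).card := by
  have h1 : S = S.filter (· < 0) ∪ (S.filter (· = 0) ∪ S.filter (0 < ·)) := by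
    ext x; simp only [Finset.mem_union, Finset.mem_filter]; grind
  conv_lhs => rw [h1]
  rw [Finset.card_union_of_disjoint, Finset.card_union_of_disjoint, Finset.filter_eq']
  · split_ifs <;> simp; omega
  · rw [Finset.disjoint_left]; intro x; simp only [Finset.mem_filter]; omega
  · rw [Finset.disjoint_left]; intro x; simp only [Finset.mem_union, Finset.mem_filter]; omega

theorem neg_one_pow_eq {a b : ℕ} (h : (a + b) % 2 = 0) : (-1 : ℂ) ^ a = (-1) ^ b := by
  rcases Nat.even_or_odd a with ha | ha <;> rcases Nat.even_or_odd b with hb | hb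
  · rw [ha.neg_one_pow, hb.neg_one_pow]
  · exfalso; rw [Nat.even_iff] at ha; rw [Nat.odd_iff] at hb; omega
  · exfalso; rw [Nat.odd_iff] at ha; rw [Nat.even_iff] at hb; omega
  · rw [ha.neg_one_pow, hb.neg_one_pow]

theorem card_filter_insert (S : Finset ℤ) (k : ℤ) (hk : k ∉ S) (r : ℤ → Prop) [DecidablePred r] :
    ((insert k S).filter r).card = (S.filter r).card + (if r k then 1 else 0) := by
  rw [Finset.filter_insert]
  split_ifs
  · rw [Finset.card_insert_of_notMem (by simp [hk])]
  · rfl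

/-- `Γ b†_k = b†_{k-1} Γ` for `k ≠ 0`, `Γ b†_0 = c_1 Γ` -/
theorem gauge_bCreate (k : ℤ) (x : AlgFock) :
    gaugeAlg (bCreate k x)
      = (if k = 0 then cAnn 1 (gaugeAlg x) else bCreate (k - 1) (gaugeAlg x)) := by
  have key : gaugeAlg ∘ₗ bCreate k
      = (if k = 0 then cAnn 1 else bCreate (k - 1)) ∘ₗ gaugeAlg := by
    refine Finsupp.lhom_ext' fun s => LinearMap.ext_ring ?_
    obtain ⟨m, n⟩ := s
    have m1 : ∀ j, j ∈ (gaugePerm (m, n)).1 ↔ (j + 1 ≠ 0 ∧ j + 1 ∈ m) ∨ (¬ 0 ∈ n ∧ j = -1) := by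
      intro j
      simp only [gaugePerm, Equiv.coe_fn_mk, Finset.mem_union, mem_image_sub_one,
        Finset.mem_erase, mem_ite_singleton]
    have m2 : ∀ j, j ∈ (gaugePerm (m, n)).2 ↔ (j - 1 ≠ 0 ∧ j - 1 ∈ n) ∨ (¬ 0 ∈ m ∧ j = 1) := by
      intro j
      simp only [gaugePerm, Equiv.coe_fn_mk, Finset.mem_union, mem_image_add_one,
        Finset.mem_erase, mem_ite_singleton]
    have l1 : (gaugeAlg ∘ₗ bCreate k) (Finsupp.single (m, n) 1)
        = if k ∈ m then 0 else ((-1 : ℂ) ^ (m.filter (· < k)).card * gaugeSign (insert k m, n))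
            • basisVec (gaugePerm (insert k m, n)) := by
      by_cases hk : k ∈ m <;> simp [bCreate, gaugeAlg, basisVec, hk]
    have l2 : gaugeAlg (Finsupp.single (m, n) 1) = gaugeSign (m, n) • basisVec (gaugePerm (m, n)) := by
      simp [gaugeAlg]
    change (gaugeAlg ∘ₗ bCreate k) (Finsupp.single (m, n) 1)
      = (if k = 0 then cAnn 1 else bCreate (k - 1)) (gaugeAlg (Finsupp.single (m, n) 1))
    rw [l1, l2, map_smul]
    have p3 := card_gaugePerm_fst' (m, n)
    have p4 := card_gaugePerm_fst (m, n) (k - 1)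
    have p5 := card_gaugePerm_snd (m, n) 1
    have p6 := card_split m
    simp only [sub_add_cancel, lt_irrefl, and_false, if_false, add_zero, sub_self] at p4 p5
    by_cases k0 : k = 0
    · subst k0
      by_cases hm : (0 : ℤ) ∈ m
      · have : (1 : ℤ) ∉ (gaugePerm (m, n)).2 := by simp [m2, hm]
        simp [cAnn, basisVec, hm, this]
      · have h1 : (1 : ℤ) ∈ (gaugePerm (m, n)).2 := by simp [m2, hm]
        have e1 : gaugePerm (insert 0 m, n)
            = ((gaugePerm (m, n)).1, (gaugePerm (m, n)).2.erase 1) := by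
          ext x <;> simp only [gaugePerm, Equiv.coe_fn_mk, Finset.mem_union, mem_image_sub_one,
            mem_image_add_one, Finset.mem_erase, mem_ite_singleton, Finset.mem_insert] <;> grind
        simp only [hm, if_false, if_true, cAnn, basisVec, Finsupp.linearCombination_single,
          h1, e1, smul_smul]
        congr 1
        by_cases hn : (0 : ℤ) ∈ n <;>
          simp only [gaugeSign, hn, hm, card_filter_insert _ _ hm, Finset.mem_insert_self, if_true,
            iff_true, iff_false, if_false, not_true, not_false_iff, lt_irrefl, add_zero,
            ← pow_add, one_mul, p5] at *
        · exact neg_one_pow_eq (by omega)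
        · rw [mul_neg_one, ← neg_one_mul, ← pow_succ']
          exact neg_one_pow_eq (by omega)
    · by_cases hm : k ∈ m
      · have : k - 1 ∈ (gaugePerm (m, n)).1 := by simp [m1, hm, k0]
        simp [bCreate, basisVec, hm, this, k0]
      · have h1 : k - 1 ∉ (gaugePerm (m, n)).1 := by simp [m1, hm, k0]
        have e1 : gaugePerm (insert k m, n)
            = (insert (k - 1) (gaugePerm (m, n)).1, (gaugePerm (m, n)).2) := by
          ext x <;> simp only [gaugePerm, Equiv.coe_fn_mk, Finset.mem_union, mem_image_sub_one,
            mem_image_add_one, Finset.mem_erase, mem_ite_singleton, Finset.mem_insert] <;> grind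
        simp only [hm, if_false, k0, bCreate, basisVec, Finsupp.linearCombination_single,
          h1, e1, smul_smul]
        congr 1
        have hi : (0 : ℤ) ∈ insert k m ↔ 0 ∈ m := by simp [Ne.symm k0]
        by_cases hn : (0 : ℤ) ∈ n <;> by_cases hm0 : (0 : ℤ) ∈ m <;> by_cases hk : 0 < k <;>
          simp only [gaugeSign, hi, hn, hm0, card_filter_insert _ _ hm, if_true, iff_true, iff_false,
            if_false, not_true, not_false_iff, ← pow_add, one_mul, mul_one, mul_neg_one, true_and,
            false_and, hk, (by omega : (-1 < k - 1) ↔ 0 < k), neg_one_mul, neg_inj] at p4 ⊢ <;>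
          exact neg_one_pow_eq (by omega)
  have := LinearMap.congr_fun key x
  simp only [LinearMap.comp_apply] at this
  rw [this]; split_ifs <;> rfl

/-- `Γ c†_k = c†_{k+1} Γ` for `k ≠ 0`, `Γ c†_0 = b_{-1} Γ` -/
theorem gauge_cCreate (k : ℤ) (x : AlgFock) :
    gaugeAlg (cCreate k x)
      = (if k = 0 then bAnn (-1) (gaugeAlg x) else cCreate (k + 1) (gaugeAlg x)) := by
  have key : gaugeAlg ∘ₗ cCreate k
      = (if k = 0 then bAnn (-1) else cCreate (k + 1)) ∘ₗ gaugeAlg := by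
    refine Finsupp.lhom_ext' fun s => LinearMap.ext_ring ?_
    obtain ⟨m, n⟩ := s
    have m1 : ∀ j, j ∈ (gaugePerm (m, n)).1 ↔ (j + 1 ≠ 0 ∧ j + 1 ∈ m) ∨ (¬ 0 ∈ n ∧ j = -1) := by
      intro j
      simp only [gaugePerm, Equiv.coe_fn_mk, Finset.mem_union, mem_image_sub_one,
        Finset.mem_erase, mem_ite_singleton]
    have m2 : ∀ j, j ∈ (gaugePerm (m, n)).2 ↔ (j - 1 ≠ 0 ∧ j - 1 ∈ n) ∨ (¬ 0 ∈ m ∧ j = 1) := by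
      intro j
      simp only [gaugePerm, Equiv.coe_fn_mk, Finset.mem_union, mem_image_add_one,
        Finset.mem_erase, mem_ite_singleton]
    have l1 : (gaugeAlg ∘ₗ cCreate k) (Finsupp.single (m, n) 1)
        = if k ∈ n then 0 else
          ((-1 : ℂ) ^ (m.card + (n.filter (· < k)).card) * gaugeSign (m, insert k n))
            • basisVec (gaugePerm (m, insert k n)) := by
      by_cases hk : k ∈ n <;> simp [cCreate, gaugeAlg, basisVec, hk]
    have l2 : gaugeAlg (Finsupp.single (m, n) 1) = gaugeSign (m, n) • basisVec (gaugePerm (m, n)) := by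
      simp [gaugeAlg]
    change (gaugeAlg ∘ₗ cCreate k) (Finsupp.single (m, n) 1)
      = (if k = 0 then bAnn (-1) else cCreate (k + 1)) (gaugeAlg (Finsupp.single (m, n) 1))
    rw [l1, l2, map_smul]
    have p3 := card_gaugePerm_fst' (m, n)
    have p4 := card_gaugePerm_snd (m, n) (k + 1)
    have p5 := card_gaugePerm_fst (m, n) (-1)
    have p6 := card_split m
    simp only [add_sub_cancel_right, lt_irrefl, and_false, if_false, add_zero,
      neg_add_cancel] at p4 p5
    by_cases k0 : k = 0
    · subst k0
      by_cases hn : (0 : ℤ) ∈ n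
      · have : (-1 : ℤ) ∉ (gaugePerm (m, n)).1 := by simp [m1, hn]
        simp [bAnn, basisVec, hn, this]
      · have h1 : (-1 : ℤ) ∈ (gaugePerm (m, n)).1 := by simp [m1, hn]
        have e1 : gaugePerm (m, insert 0 n)
            = ((gaugePerm (m, n)).1.erase (-1), (gaugePerm (m, n)).2) := by
          ext x <;> simp only [gaugePerm, Equiv.coe_fn_mk, Finset.mem_union, mem_image_sub_one,
            mem_image_add_one, Finset.mem_erase, mem_ite_singleton, Finset.mem_insert] <;> grind
        simp only [hn, if_false, if_true, bAnn, basisVec, Finsupp.linearCombination_single,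
          h1, e1, smul_smul]
        congr 1
        by_cases hm : (0 : ℤ) ∈ m <;>
          simp only [gaugeSign, hn, hm, card_filter_insert _ _ hn, Finset.mem_insert_self, if_true,
            iff_true, iff_false, if_false, not_true, not_false_iff, lt_irrefl, add_zero,
            ← pow_add, mul_one, one_mul, p5] at p6 ⊢
        · rw [← pow_succ']
          exact neg_one_pow_eq (by omega)
        · exact neg_one_pow_eq (by omega)
    · by_cases hn : k ∈ n
      · have : k + 1 ∈ (gaugePerm (m, n)).2 := by simp [m2, hn, k0]
        simp [cCreate, basisVec, hn, this, k0]
      · have h1 : k + 1 ∉ (gaugePerm (m, n)).2 := by simp [m2, hn, k0]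
        have e1 : gaugePerm (m, insert k n)
            = ((gaugePerm (m, n)).1, insert (k + 1) (gaugePerm (m, n)).2) := by
          ext x <;> simp only [gaugePerm, Equiv.coe_fn_mk, Finset.mem_union, mem_image_sub_one,
            mem_image_add_one, Finset.mem_erase, mem_ite_singleton, Finset.mem_insert] <;> grind
        simp only [hn, if_false, k0, cCreate, basisVec, Finsupp.linearCombination_single,
          h1, e1, smul_smul]
        congr 1
        have hi : (0 : ℤ) ∈ insert k n ↔ 0 ∈ n := by simp [Ne.symm k0]
        by_cases hn0 : (0 : ℤ) ∈ n <;> by_cases hm0 : (0 : ℤ) ∈ m <;> by_cases hk : 0 < k <;>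
          simp only [gaugeSign, hi, hn0, hm0, card_filter_insert _ _ hn, if_true, iff_true, iff_false,
            if_false, not_true, not_false_iff, ← pow_add, one_mul, mul_one, mul_neg_one, true_and,
            false_and, hk, (by omega : (1 < k + 1) ↔ 0 < k), (by omega : k < 0 ↔ ¬ 0 < k),
            neg_one_mul, neg_inj] at p3 p4 ⊢ <;>
          exact neg_one_pow_eq (by omega)
  have := LinearMap.congr_fun key x
  simp only [LinearMap.comp_apply] at this
  rw [this]; split_ifs <;> rfl

/-! ### The Hamiltonian `H₀` on its domain `𝓓` -/

/-- `𝓓`: smooth functions of `a ∈ ℝ` (in the Fock space norm) with values in `𝓕₀` which satisfy the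
twisted periodicity condition `Ψ(a + 2π/L) = Γ⁻¹ Ψ(a)`. -/
def IsInDomain (L : ℝ) (Ψ : ℝ → AlgFock) : Prop :=
  (∀ a, Ψ a ∈ zeroCharge) ∧
  ContDiff ℝ ∞ (fun a => toFock (Ψ a)) ∧
  ∀ a, toFock (Ψ (a + 2 * Real.pi / L)) = gauge.symm (toFock (Ψ a))

/-- `(H₀Ψ)(a) = -(e²/2L) Ψ''(a) + (π/2L) (Q^{5,reg})² Ψ(a) + T Ψ(a)`. -/
def hamiltonian (e L : ℝ) (Ψ : ℝ → AlgFock) (a : ℝ) : Fock :=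
  -((e ^ 2 / (2 * L) : ℝ) : ℂ) • deriv (deriv fun a' => toFock (Ψ a')) a
    + toFock (potentialPart L a (Ψ a))

/-- Lebesgue measure on `[0, 2π/L]`. -/
def circleMeasure (L : ℝ) : Measure ℝ := volume.restrict (Set.Icc 0 (2 * Real.pi / L))

/-- `L²([0, 2π/L]; Fock)`. The Hilbert space `𝓚 = L²([0, 2π/L]; 𝓗₀)` is the closed subspace of the
`𝓗₀`-valued elements; all the elements considered below lie in it. -/
abbrev StateSpace (L : ℝ) : Type := Lp Fock 2 (circleMeasure L)

/-- The graph of `H₀`: the pairs `(Ψ, H₀Ψ)` with `Ψ ∈ 𝓓` (and `H₀Ψ` square integrable). -/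
def hamiltonianGraph (e L : ℝ) : Set (StateSpace L × StateSpace L) :=
  {p | ∃ Ψ : ℝ → AlgFock, IsInDomain L Ψ ∧
    (p.1 =ᵐ[circleMeasure L] fun a => toFock (Ψ a)) ∧
    (p.2 =ᵐ[circleMeasure L] hamiltonian e L Ψ)}

/-! ### The vacuum -/

/-- `E₀ = e / (2√π)` -/
def groundEnergy (e : ℝ) : ℝ := e / (2 * √Real.pi)

/-- `f(x) = L^{1/4} π^{-3/8} e^{-1/4} exp(-L x² / (2 √π e))` -/
def gaussian (e L x : ℝ) : ℝ :=
  L ^ (1 / 4 : ℝ) / (Real.pi ^ (3 / 8 : ℝ) * e ^ (1 / 4 : ℝ))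
    * Real.exp (-(L * x ^ 2) / (2 * √Real.pi * e))

/-- The coefficient `f_P(a) = f(a - (2π/L)(P - 1/2))` of `Ω_P`. -/
def vacuumCoeff (e L : ℝ) (P : ℤ) (a : ℝ) : ℂ :=
  (gaussian e L (a - 2 * Real.pi / L * ((P : ℝ) - 1 / 2)) : ℂ)

/-- `Ψ₀(a) = ∑_P f(a - (2π/L)(P - 1/2)) Ω_P`. -/
def vacuum (e L a : ℝ) : Fock := ∑' P : ℤ, vacuumCoeff e L P a • toFock (unexcited P)

end Schwinger

end

noncomputable section

open MeasureTheory
open scoped ContDiff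

namespace Schwinger

/-! ### Coordinates and inner products of finite particle vectors -/

/-! Lower bound. The axial charge is diagonal in the basis `Ω_s` with integer eigenvalue `q_s`, and
`T` is a positive multiple of a sum of terms `A†A`, hence `≥ 0`. In the coordinate `u = Ψ_s` the
remaining form is that of a harmonic oscillator on one period, with `w = q_s - aL/π - 1`. Expanding
`|e u' - √π w u|² ≥ 0` and dividing by `2L` gives the energy density `≥ E₀ |u|² + g'`, where `g =
(e√π/2L) w |u|²`; the constant `E₀` comes from `w' = -L/π` (`oscillator_bound`).

The boundary values of `g` do not vanish for a single `s`. The large gauge transformation lowers the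
axial charge by 2 (`axialNumber_gaugePerm`), exactly the change of `aL/π` over a period, so twisted
periodicity identifies the boundary term of `s` at `2π/L` with that of `gaugePerm s` at `0`. Summed
over `s` these terms are rearrangements of one another, and they are finite because `Ψ 0` is a
finite particle vector. The energies may sum to infinity, so the summation is carried out in
`ENNReal`, with signed quantities split into positive and negative parts
(`oscillator_bound_lintegral`). Unitarity of `Γ` removes the boundary terms when `-⟨Ψ, Ψ''⟩` is
integrated by parts.

Attainment. The states `Ω_P` have axial charge `2P` and are killed by `T`, so on `Ω_P` the potential
is `(L/2π) x²` with `x = a - (2π/L)(P - 1/2)`. Since `Γ⁻¹ Ω_P = Ω_{P+1}`, each decaying profile `φ`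
on the whole line yields a twisted periodic function `latticeSum L φ`. This unfolds the circle into
`ℝ`: norms become `L²(ℝ)` norms and `H₀` becomes the one-variable oscillator, whose ground state is
the Gaussian.

`Ψ₀` is not in `𝓓`, because `Ψ₀(a)` has infinitely many nonzero coordinates. Cutting the Gaussian
off smoothly at distance `1/ε` gives elements of `𝓓`; they and their images under `H₀` converge to
`Ψ₀` and `E₀Ψ₀` with an error `O(ε)` (`vacuumLp_mem_closure`). -/

theorem toFock_basisVec (s : Config) : toFock (basisVec s) = (lp.single 2 s (1 : ℂ) : Fock) := by
  simp [toFock, basisVec]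

theorem toFock_apply (x : AlgFock) (s : Config) : toFock x s = x s := by
  induction x using Finsupp.induction_linear with
  | zero => simp
  | add x y hx hy => simp [hx, hy]
  | single t c =>
    by_cases h : s = t
    · subst h; simp [toFock, lp.single_apply]
    · simp [toFock, lp.single_apply, h]

theorem norm_toFock_basisVec (s : Config) : ‖toFock (basisVec s)‖ = 1 := by
  rw [toFock_basisVec, lp.norm_single (by simp)]; simp

theorem linearMap_ext_basisVec {M : Type*} [AddCommGroup M] [Module ℂ M] {A B : AlgFock →ₗ[ℂ] M}
    (h : ∀ s, A (basisVec s) = B (basisVec s)) : A = B :=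
  Finsupp.lhom_ext' fun s => LinearMap.ext_ring (h s)

theorem eq_sum_basisVec (x : AlgFock) : x = ∑ s ∈ x.support, x s • basisVec s := by
  conv_lhs => rw [← Finsupp.sum_single x]
  simp [Finsupp.sum, basisVec]

theorem linearCombination_basisVec (v : Config → AlgFock) (s : Config) :
    Finsupp.linearCombination ℂ v (basisVec s) = v s := by simp [basisVec]

theorem inner_toFock (x y : AlgFock) :
    inner ℂ (toFock x) (toFock y) = ∑ s ∈ x.support, starRingEnd ℂ (x s) * y s := by
  rw [lp.inner_eq_tsum, tsum_eq_sum (s := x.support)]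
  · refine Finset.sum_congr rfl fun s _ => ?_
    rw [toFock_apply, toFock_apply, RCLike.inner_apply, mul_comm]
  · intro s hs
    rw [toFock_apply, toFock_apply, Finsupp.notMem_support_iff.1 hs, inner_zero_left]

/-! ### Formal adjoints -/

/-- `B` is the adjoint of `A` on finite particle vectors. -/
def FormalAdjoint (A B : AlgFock →ₗ[ℂ] AlgFock) : Prop :=
  ∀ x y, inner ℂ (toFock (A x)) (toFock y) = inner ℂ (toFock x) (toFock (B y))

namespace FormalAdjoint

variable {A A' B B' : AlgFock →ₗ[ℂ] AlgFock}

theorem symm (h : FormalAdjoint A B) : FormalAdjoint B A := fun x y => by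
  rw [← inner_conj_symm, ← h, inner_conj_symm]

theorem add (h : FormalAdjoint A B) (h' : FormalAdjoint A' B') :
    FormalAdjoint (A + A') (B + B') := fun x y => by
  simp only [LinearMap.add_apply, map_add, inner_add_left, inner_add_right, h x y, h' x y]

theorem neg (h : FormalAdjoint A B) : FormalAdjoint (-A) (-B) := fun x y => by
  simp only [LinearMap.neg_apply, map_neg, inner_neg_left, inner_neg_right, h x y]

theorem sub (h : FormalAdjoint A B) (h' : FormalAdjoint A' B') :
    FormalAdjoint (A - A') (B - B') := fun x y => by
  simp only [LinearMap.sub_apply, map_sub, inner_sub_left, inner_sub_right, h x y, h' x y]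

theorem comp (h : FormalAdjoint A B) (h' : FormalAdjoint A' B') :
    FormalAdjoint (A ∘ₗ A') (B' ∘ₗ B) := fun x y => by
  simp only [LinearMap.comp_apply, h _ y, h' x _]

/-- Sesquilinearity reduces adjointness to matrix elements between basis vectors. -/
theorem of_basisVec (h : ∀ s t, starRingEnd ℂ (A (basisVec s) t) = B (basisVec t) s) :
    FormalAdjoint A B := fun x y => by
  have key : ∀ s t, inner ℂ (toFock (A (basisVec s))) (toFock (basisVec t))
      = inner ℂ (toFock (basisVec s)) (toFock (B (basisVec t))) := fun s t => by
    rw [toFock_basisVec s, toFock_basisVec t, lp.inner_single_left, lp.inner_single_right,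
      toFock_apply, toFock_apply]
    simpa using h s t
  rw [eq_sum_basisVec x, eq_sum_basisVec y]
  simp only [map_sum, map_smul, sum_inner, inner_sum, inner_smul_left, inner_smul_right, key]

end FormalAdjoint

/-- The two fermionic signs agree because inserting or removing mode `k` does not change the
occupied modes strictly below `k`. -/
theorem formalAdjoint_bCreate (k : ℤ) : FormalAdjoint (bCreate k) (bAnn k) := by
  refine .of_basisVec ?_
  rintro ⟨m, n⟩ ⟨m', n'⟩
  simp only [bCreate, bAnn, linearCombination_basisVec]
  by_cases hk : k ∈ m <;> by_cases hk' : k ∈ m'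
  · have h : ((m'.erase k, n') : Config) ≠ (m, n) := fun h => by
      have := congrArg Prod.fst h; simp only at this; rw [← this] at hk; simp at hk
    simp [hk, hk', basisVec, h]
  · simp [hk, hk']
  · by_cases h : m' = insert k m ∧ n' = n
    · obtain ⟨rfl, rfl⟩ := h
      have : (insert k m).filter (· < k) = m.filter (· < k) := by
        rw [Finset.filter_insert]; simp
      simp [hk, basisVec, this]
    · have h1 : ((insert k m, n) : Config) ≠ (m', n') := fun h' => by
        rw [Prod.mk.injEq] at h'; exact h ⟨h'.1.symm, h'.2.symm⟩
      have h2 : ((m'.erase k, n') : Config) ≠ (m, n) := fun h' => by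
        rw [Prod.mk.injEq] at h'
        exact h ⟨by rw [← h'.1, Finset.insert_erase hk'], h'.2⟩
      simp [hk, hk', basisVec, h1, h2]
  · have h : ((insert k m, n) : Config) ≠ (m', n') := fun h => by
      have := congrArg Prod.fst h; simp only at this; rw [← this] at hk'; simp at hk'
    simp [hk, hk', basisVec, h]

theorem formalAdjoint_cCreate (k : ℤ) : FormalAdjoint (cCreate k) (cAnn k) := by
  refine .of_basisVec ?_
  rintro ⟨m, n⟩ ⟨m', n'⟩
  simp only [cCreate, cAnn, linearCombination_basisVec]
  by_cases hk : k ∈ n <;> by_cases hk' : k ∈ n'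
  · have h : ((m', n'.erase k) : Config) ≠ (m, n) := fun h => by
      have := congrArg Prod.snd h; simp only at this; rw [← this] at hk; simp at hk
    simp [hk, hk', basisVec, h]
  · simp [hk, hk']
  · by_cases h : m' = m ∧ n' = insert k n
    · obtain ⟨rfl, rfl⟩ := h
      have : (insert k n).filter (· < k) = n.filter (· < k) := by
        rw [Finset.filter_insert]; simp
      simp [hk, basisVec, this]
    · have h1 : ((m, insert k n) : Config) ≠ (m', n') := fun h' => by
        rw [Prod.mk.injEq] at h'; exact h ⟨h'.1.symm, h'.2.symm⟩
      have h2 : ((m', n'.erase k) : Config) ≠ (m, n) := fun h' => by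
        rw [Prod.mk.injEq] at h'
        exact h ⟨h'.1, by rw [← h'.2, Finset.insert_erase hk']⟩
      simp [hk, hk', basisVec, h1, h2]
  · have h : ((m, insert k n) : Config) ≠ (m', n') := fun h => by
      have := congrArg Prod.snd h; simp only at this; rw [← this] at hk'; simp at hk'
    simp [hk, hk', basisVec, h]

/-! ### Locally finite sums of operators -/

/-- `∑_{k, p k} A_k`, defined on basis vectors and extended linearly. -/
def opSum (p : ℤ → Prop) (A : ℤ → AlgFock →ₗ[ℂ] AlgFock) : AlgFock →ₗ[ℂ] AlgFock :=
  Finsupp.linearCombination ℂ fun s => ∑ᶠ (k : ℤ) (_ : p k), A k (basisVec s)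

/-- Only finitely many terms of `∑_{k, p k} A_k` act nontrivially on each basis vector. -/
def LocallyFiniteOps (p : ℤ → Prop) (A : ℤ → AlgFock →ₗ[ℂ] AlgFock) : Prop :=
  ∀ s, ∃ F : Finset ℤ, ∀ k, p k → A k (basisVec s) ≠ 0 → k ∈ F

/-- The union over the support of `x` of the finite index sets works. Allowing every larger `F'`
lets two vectors, or two operators, be treated with one common index set. -/
theorem LocallyFiniteOps.exists_opSum_eq {p : ℤ → Prop} {A : ℤ → AlgFock →ₗ[ℂ] AlgFock}
    (hA : LocallyFiniteOps p A) (x : AlgFock) :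
    ∃ F : Finset ℤ, ∀ F', F ⊆ F' → opSum p A x = ∑ k ∈ F', (∑ᶠ _ : p k, A k x) := by
  classical
  choose F hF using hA
  refine ⟨x.support.biUnion F, fun F' hF' => ?_⟩
  have h1 : ∀ s ∈ x.support, opSum p A (basisVec s)
      = ∑ k ∈ F', if p k then A k (basisVec s) else 0 := fun s hs => by
    rw [opSum, linearCombination_basisVec]
    simp_rw [finsum_eq_if]
    refine finsum_eq_sum_of_support_subset _ fun k hk => ?_
    rw [Function.mem_support] at hk
    by_cases hp : p k
    · simp only [hp, if_true] at hk
      exact hF' (Finset.mem_biUnion.2 ⟨s, hs, hF s k hp hk⟩)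
    · simp [hp] at hk
  simp_rw [finsum_eq_if]
  conv_lhs => rw [eq_sum_basisVec x]
  rw [map_sum, Finset.sum_congr rfl fun s hs => by rw [map_smul, h1 s hs, Finset.smul_sum],
    Finset.sum_comm]
  refine Finset.sum_congr rfl fun k _ => ?_
  by_cases hp : p k
  · simp only [hp, if_true]
    conv_rhs => rw [eq_sum_basisVec x]
    simp
  · simp [hp]

theorem LocallyFiniteOps.formalAdjoint {p : ℤ → Prop} {A B : ℤ → AlgFock →ₗ[ℂ] AlgFock}
    (hA : LocallyFiniteOps p A) (hB : LocallyFiniteOps p B)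
    (h : ∀ k, FormalAdjoint (A k) (B k)) : FormalAdjoint (opSum p A) (opSum p B) := by
  classical
  intro x y
  obtain ⟨F, hF⟩ := hA.exists_opSum_eq x
  obtain ⟨G, hG⟩ := hB.exists_opSum_eq y
  rw [hF _ Finset.subset_union_left, hG _ (Finset.subset_union_right (s₁ := F)), map_sum, map_sum,
    sum_inner, inner_sum]
  refine Finset.sum_congr rfl fun k _ => ?_
  simp_rw [finsum_eq_if]
  split_ifs
  · exact h k x y
  · simp

/-- Meant for terms whose rightmost factor annihilates mode `k + j`: that mode must then be
occupied, which leaves finitely many `k`. -/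
theorem LocallyFiniteOps.of_mem {p : ℤ → Prop} {A : ℤ → AlgFock →ₗ[ℂ] AlgFock} (j : ℤ)
    (F : Config → Finset ℤ)
    (h : ∀ s k, p k → A k (basisVec s) ≠ 0 → k + j ∈ F s) : LocallyFiniteOps p A :=
  fun s => ⟨(F s).image (· - j), fun k hp hk =>
    Finset.mem_image.2 ⟨k + j, h s k hp hk, by ring⟩⟩

/-! ### Bilinears on basis vectors -/

theorem bAnn_basisVec_of_notMem {k : ℤ} {s : Config} (h : k ∉ s.1) : bAnn k (basisVec s) = 0 := by
  simp [bAnn, linearCombination_basisVec, h]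

theorem cAnn_basisVec_of_notMem {k : ℤ} {s : Config} (h : k ∉ s.2) : cAnn k (basisVec s) = 0 := by
  simp [cAnn, linearCombination_basisVec, h]

/-- Pauli exclusion. The condition `j ≠ k` matters: annihilating mode `k` would otherwise make room
for the created particle. -/
theorem bCreate_bAnn_of_mem {j k : ℤ} {s : Config} (h : j ∈ s.1) (hjk : j ≠ k) :
    bCreate j (bAnn k (basisVec s)) = 0 := by
  by_cases hk : k ∈ s.1 <;> simp [bAnn, bCreate, linearCombination_basisVec, hk, h, hjk]

theorem cCreate_cAnn_of_mem {j k : ℤ} {s : Config} (h : j ∈ s.2) (hjk : j ≠ k) :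
    cCreate j (cAnn k (basisVec s)) = 0 := by
  by_cases hk : k ∈ s.2 <;> simp [cAnn, cCreate, linearCombination_basisVec, hk, h, hjk]

theorem cAnn_bAnn_of_notMem {j k : ℤ} {s : Config} (h : j ∉ s.2) :
    cAnn j (bAnn k (basisVec s)) = 0 := by
  by_cases hk : k ∈ s.1 <;> simp [bAnn, cAnn, linearCombination_basisVec, hk, h]

theorem bCreate_bAnn_self (k : ℤ) (s : Config) :
    bCreate k (bAnn k (basisVec s)) = if k ∈ s.1 then basisVec s else 0 := by
  by_cases hk : k ∈ s.1
  · have : (s.1.erase k).filter (· < k) = s.1.filter (· < k) := by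
      ext x; simp only [Finset.mem_filter, Finset.mem_erase]; grind
    simp [bAnn, bCreate, linearCombination_basisVec, hk, this, smul_smul, ← mul_pow]
  · simp [bAnn_basisVec_of_notMem hk, hk]

theorem cCreate_cAnn_self (k : ℤ) (s : Config) :
    cCreate k (cAnn k (basisVec s)) = if k ∈ s.2 then basisVec s else 0 := by
  by_cases hk : k ∈ s.2
  · have : (s.2.erase k).filter (· < k) = s.2.filter (· < k) := by
      ext x; simp only [Finset.mem_filter, Finset.mem_erase]; grind
    simp [cAnn, cCreate, linearCombination_basisVec, hk, this, smul_smul, ← mul_pow]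
  · simp [cAnn_basisVec_of_notMem hk, hk]

/-! ### The axial charge -/

/-- The eigenvalue of the axial charge on `Ω_s`. -/
def axialNumber (s : Config) : ℤ :=
  (s.1.filter (0 ≤ ·)).card - (s.1.filter (· < 0)).card - (s.2.filter (0 < ·)).card
    + (s.2.filter (· ≤ 0)).card

theorem finsum_mem_ite (S : Finset ℤ) (p : ℤ → Prop) [DecidablePred p] (v : AlgFock) :
    (∑ᶠ (n : ℤ) (_ : p n), if n ∈ S then v else 0) = ((S.filter p).card : ℂ) • v := by
  simp_rw [finsum_eq_if]
  rw [finsum_eq_sum_of_support_subset (s := S.filter p)]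
  · rw [Finset.sum_congr rfl (g := fun _ => v)]
    · rw [Finset.sum_const, Nat.cast_smul_eq_nsmul]
    · intro n hn
      rw [Finset.mem_filter] at hn
      simp [hn]
  · intro n hn
    simp only [Function.mem_support, ne_eq, ite_eq_right_iff, not_forall] at hn
    obtain ⟨h1, h2, -⟩ := hn
    simp [h1, h2]

theorem axialCharge_basisVec (s : Config) :
    axialCharge (basisVec s) = (axialNumber s : ℂ) • basisVec s := by
  rw [axialCharge, linearCombination_basisVec]
  simp_rw [bCreate_bAnn_self, cCreate_cAnn_self]
  rw [finsum_mem_ite, finsum_mem_ite, finsum_mem_ite, finsum_mem_ite, axialNumber]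
  push_cast
  module

/-- The eigenvalue of the regularized axial charge on `Ω_s`. -/
def axialRegNumber (L a : ℝ) (s : Config) : ℝ := axialNumber s - (a * L / Real.pi + 1)

theorem axialChargeReg_basisVec (L a : ℝ) (s : Config) :
    axialChargeReg L a (basisVec s) = (axialRegNumber L a s : ℂ) • basisVec s := by
  simp only [axialChargeReg, LinearMap.sub_apply, LinearMap.smul_apply, LinearMap.id_apply,
    axialCharge_basisVec, axialRegNumber]
  push_cast
  module

theorem axialChargeReg_apply (L a : ℝ) (x : AlgFock) (s : Config) :
    axialChargeReg L a x s = axialRegNumber L a s * x s := by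
  conv_lhs => rw [eq_sum_basisVec x]
  simp only [map_sum, map_smul, axialChargeReg_basisVec, Finsupp.finsetSum_apply,
    Finsupp.smul_apply, smul_eq_mul]
  simp only [basisVec, Finsupp.single_apply, mul_ite, mul_one, mul_zero]
  rw [Finset.sum_ite_eq']
  split_ifs with h
  · ring
  · rw [Finsupp.notMem_support_iff.1 h]; ring

/-- Away from the modes `0` the shift preserves the sign with which a mode is counted. A particle in
`b_0` (counted `+1`) is exchanged for the absence of one in `c_1` (counted `-1`), and likewise `c_0`
for `b_{-1}`; whether the mode is filled or empty, each exchange costs 1. The total 2 is the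
increment of `aL/π` over a period. -/
theorem axialNumber_gaugePerm (s : Config) : axialNumber (gaugePerm s) = axialNumber s - 2 := by
  have h1 := card_filter_shift s.1 (-1) (0 ∈ s.2) (0 ≤ ·)
  have h2 := card_filter_shift s.1 (-1) (0 ∈ s.2) (· < 0)
  have h3 := card_filter_shift s.2 1 (0 ∈ s.1) (0 < ·)
  have h4 := card_filter_shift s.2 1 (0 ∈ s.1) (· ≤ 0)
  have e1 : s.1.filter (fun x => 0 ≤ x + -1) = s.1.filter (0 < ·) :=
    Finset.filter_congr fun x _ => by omega
  have e2 : (s.1.filter (fun x => x + -1 < 0)).card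
      = (s.1.filter (· < 0)).card + if 0 ∈ s.1 then 1 else 0 := by
    have : s.1.filter (fun x => x + -1 < 0) = s.1.filter (· < 0) ∪ s.1.filter (· = 0) := by
      rw [← Finset.filter_or]; exact Finset.filter_congr fun x _ => by omega
    rw [this, Finset.card_union_of_disjoint (Finset.disjoint_filter.2 fun x _ => by omega),
      Finset.filter_eq']
    split_ifs <;> simp
  have e3 : (s.2.filter (fun x => 0 < x + 1)).card
      = (s.2.filter (0 < ·)).card + if 0 ∈ s.2 then 1 else 0 := by
    have : s.2.filter (fun x => 0 < x + 1) = s.2.filter (0 < ·) ∪ s.2.filter (· = 0) := by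
      rw [← Finset.filter_or]; exact Finset.filter_congr fun x _ => by omega
    rw [this, Finset.card_union_of_disjoint (Finset.disjoint_filter.2 fun x _ => by omega),
      Finset.filter_eq']
    split_ifs <;> simp
  have e4 : s.2.filter (fun x => x + 1 ≤ 0) = s.2.filter (· < 0) :=
    Finset.filter_congr fun x _ => by omega
  have e5 : (s.1.filter (0 ≤ ·)).card
      = (s.1.filter (0 < ·)).card + if 0 ∈ s.1 then 1 else 0 := by
    have : s.1.filter (0 ≤ ·) = s.1.filter (0 < ·) ∪ s.1.filter (· = 0) := by
      rw [← Finset.filter_or]; exact Finset.filter_congr fun x _ => by omega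
    rw [this, Finset.card_union_of_disjoint (Finset.disjoint_filter.2 fun x _ => by omega),
      Finset.filter_eq']
    split_ifs <;> simp
  have e6 : (s.2.filter (· ≤ 0)).card
      = (s.2.filter (· < 0)).card + if 0 ∈ s.2 then 1 else 0 := by
    have : s.2.filter (· ≤ 0) = s.2.filter (· < 0) ∪ s.2.filter (· = 0) := by
      rw [← Finset.filter_or]; exact Finset.filter_congr fun x _ => by omega
    rw [this, Finset.card_union_of_disjoint (Finset.disjoint_filter.2 fun x _ => by omega),
      Finset.filter_eq']
    split_ifs <;> simp
  have g1 : (gaugePerm s).1 = (s.1.erase 0).image (· + -1) ∪ (if 0 ∈ s.2 then ∅ else {-1}) := rfl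
  have g2 : (gaugePerm s).2 = (s.2.erase 0).image (· + 1) ∪ (if 0 ∈ s.1 then ∅ else {1}) := rfl
  rw [axialNumber, axialNumber, g1, g2]
  rw [e1] at h1; rw [e2] at h2; rw [e3] at h3; rw [e4] at h4
  by_cases hm : (0 : ℤ) ∈ s.1 <;> by_cases hn : (0 : ℤ) ∈ s.2 <;>
    simp [hm, hn] at h1 h2 h3 h4 e5 e6 ⊢ <;> omega

/-! ### The density operators -/

theorem rhoRPlus_eq (m : ℤ) : rhoRPlus m
    = -(opSum (m < ·) fun k => cCreate k ∘ₗ cAnn (k - m))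
      + (opSum (fun k => 0 < k ∧ k ≤ m) fun k => bCreate (-k + m) ∘ₗ cCreate k)
      + opSum (0 ≤ ·) fun k => bCreate (k + m) ∘ₗ bAnn k :=
  linearMap_ext_basisVec fun s => by
    simp only [rhoRPlus, opSum, linearCombination_basisVec, LinearMap.add_apply,
      LinearMap.neg_apply, LinearMap.comp_apply]

theorem rhoRMinus_eq (m : ℤ) : rhoRMinus m
    = -(opSum (m < ·) fun k => cCreate (k - m) ∘ₗ cAnn k)
      + (opSum (fun k => 0 < k ∧ k ≤ m) fun k => cAnn k ∘ₗ bAnn (-k + m))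
      + opSum (0 ≤ ·) fun k => bCreate k ∘ₗ bAnn (k + m) :=
  linearMap_ext_basisVec fun s => by
    simp only [rhoRMinus, opSum, linearCombination_basisVec, LinearMap.add_apply,
      LinearMap.neg_apply, LinearMap.comp_apply]

theorem rhoLPlus_eq (m : ℤ) : rhoLPlus m
    = (opSum (· < -m) fun k => bCreate (k + m) ∘ₗ bAnn k)
      + (opSum (fun k => -m ≤ k ∧ k < 0) fun k => cAnn (-k - m) ∘ₗ bAnn k)
      - opSum (· ≤ 0) fun k => cCreate k ∘ₗ cAnn (k - m) :=
  linearMap_ext_basisVec fun s => by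
    simp only [rhoLPlus, opSum, linearCombination_basisVec, LinearMap.add_apply,
      LinearMap.sub_apply, LinearMap.comp_apply]

theorem rhoLMinus_eq (m : ℤ) : rhoLMinus m
    = (opSum (· < -m) fun k => bCreate k ∘ₗ bAnn (k + m))
      + (opSum (fun k => -m ≤ k ∧ k < 0) fun k => bCreate k ∘ₗ cCreate (-k - m))
      - opSum (· ≤ 0) fun k => cCreate (k - m) ∘ₗ cAnn k :=
  linearMap_ext_basisVec fun s => by
    simp only [rhoLMinus, opSum, linearCombination_basisVec, LinearMap.add_apply,
      LinearMap.sub_apply, LinearMap.comp_apply]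

theorem locallyFiniteOps_comp_bAnn (p : ℤ → Prop) (A : ℤ → AlgFock →ₗ[ℂ] AlgFock) (j : ℤ) :
    LocallyFiniteOps p fun k => A k ∘ₗ bAnn (k + j) :=
  .of_mem j (fun s => s.1) fun s k _ hk => by
    by_contra h
    exact hk (by rw [LinearMap.comp_apply, bAnn_basisVec_of_notMem h, map_zero])

theorem locallyFiniteOps_comp_cAnn (p : ℤ → Prop) (A : ℤ → AlgFock →ₗ[ℂ] AlgFock) (j : ℤ) :
    LocallyFiniteOps p fun k => A k ∘ₗ cAnn (k + j) :=
  .of_mem j (fun s => s.2) fun s k _ hk => by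
    by_contra h
    exact hk (by rw [LinearMap.comp_apply, cAnn_basisVec_of_notMem h, map_zero])

theorem locallyFiniteOps_of_bounded {p : ℤ → Prop} (A : ℤ → AlgFock →ₗ[ℂ] AlgFock) (a b : ℤ)
    (h : ∀ k, p k → a ≤ k ∧ k ≤ b) : LocallyFiniteOps p A :=
  fun _ => ⟨Finset.Icc a b, fun k hk _ => Finset.mem_Icc.2 (h k hk)⟩

/-- The sums for `ϱ^R(±m)` are defined independently; they match term by term, each bilinear being
the adjoint of its partner. -/
theorem formalAdjoint_rhoR (m : ℤ) : FormalAdjoint (rhoRPlus m) (rhoRMinus m) := by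
  rw [rhoRPlus_eq, rhoRMinus_eq]
  refine ((LocallyFiniteOps.formalAdjoint ?_ ?_ fun k => ?_).neg.add
    (LocallyFiniteOps.formalAdjoint ?_ ?_ fun k => ?_)).add
    (LocallyFiniteOps.formalAdjoint ?_ ?_ fun k => ?_)
  · exact locallyFiniteOps_comp_cAnn _ _ (-m)
  · simpa using locallyFiniteOps_comp_cAnn (m < ·) (fun k => cCreate (k - m)) 0
  · exact (formalAdjoint_cCreate _).comp (formalAdjoint_cCreate _).symm
  · exact locallyFiniteOps_of_bounded _ 0 m fun k hk => ⟨hk.1.le, hk.2⟩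
  · exact locallyFiniteOps_of_bounded _ 0 m fun k hk => ⟨hk.1.le, hk.2⟩
  · exact (formalAdjoint_bCreate _).comp (formalAdjoint_cCreate _)
  · simpa using locallyFiniteOps_comp_bAnn (0 ≤ ·) (fun k => bCreate (k + m)) 0
  · exact locallyFiniteOps_comp_bAnn _ _ m
  · exact (formalAdjoint_bCreate _).comp (formalAdjoint_bCreate _).symm

/-- For the left movers it is `ϱ^L(m)` that removes pairs, so the roles of `m` and `-m` are
exchanged relative to `ϱ^R`, as in the definition of `T`. -/
theorem formalAdjoint_rhoL (m : ℤ) : FormalAdjoint (rhoLMinus m) (rhoLPlus m) := by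
  rw [rhoLPlus_eq, rhoLMinus_eq]
  refine ((LocallyFiniteOps.formalAdjoint ?_ ?_ fun k => ?_).add
    (LocallyFiniteOps.formalAdjoint ?_ ?_ fun k => ?_)).sub
    (LocallyFiniteOps.formalAdjoint ?_ ?_ fun k => ?_)
  · exact locallyFiniteOps_comp_bAnn _ _ m
  · simpa using locallyFiniteOps_comp_bAnn (· < -m) (fun k => bCreate (k + m)) 0
  · exact (formalAdjoint_bCreate _).comp (formalAdjoint_bCreate _).symm
  · exact locallyFiniteOps_of_bounded _ (-m) 0 fun k hk => ⟨hk.1, hk.2.le⟩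
  · exact locallyFiniteOps_of_bounded _ (-m) 0 fun k hk => ⟨hk.1, hk.2.le⟩
  · exact (formalAdjoint_bCreate _).comp (formalAdjoint_cCreate _)
  · simpa using locallyFiniteOps_comp_cAnn (· ≤ 0) (fun k => cCreate (k - m)) 0
  · exact locallyFiniteOps_comp_cAnn _ _ (-m)
  · exact (formalAdjoint_cCreate _).comp (formalAdjoint_cCreate _).symm

theorem opSum_basisVec_eq_zero {p : ℤ → Prop} {A : ℤ → AlgFock →ₗ[ℂ] AlgFock} {s : Config}
    (h : ∀ k, p k → A k (basisVec s) = 0) : opSum p A (basisVec s) = 0 := by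
  rw [opSum, linearCombination_basisVec]
  exact finsum_mem_eq_zero_of_forall_eq_zero (s := {k | p k}) h

/-- A blocking criterion: `h1` and `h3` say that every hop ends in an occupied mode, `h2` that there
is no pair to annihilate, and `hm` keeps the source and target of a hop distinct. It serves both to
show that `T` is locally finite (large `m`) and that `T` kills the unexcited states. -/
theorem rhoRMinus_basisVec_eq_zero {m : ℤ} {s : Config}
    (h1 : ∀ k, m < k → k ∈ s.2 → k - m ∈ s.2)
    (h2 : ∀ k, 0 < k → k ≤ m → k ∈ s.2 → -k + m ∉ s.1)
    (h3 : ∀ k, 0 ≤ k → k + m ∈ s.1 → k ∈ s.1) (hm : 1 ≤ m) :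
    rhoRMinus m (basisVec s) = 0 := by
  rw [rhoRMinus_eq, LinearMap.add_apply, LinearMap.add_apply, LinearMap.neg_apply,
    opSum_basisVec_eq_zero, opSum_basisVec_eq_zero, opSum_basisVec_eq_zero]
  · simp
  · intro k hk
    by_cases h : k + m ∈ s.1
    · exact bCreate_bAnn_of_mem (h3 k hk h) (by omega)
    · rw [LinearMap.comp_apply, bAnn_basisVec_of_notMem h, map_zero]
  · intro k hk
    by_cases h : k ∈ s.2
    · rw [LinearMap.comp_apply, bAnn_basisVec_of_notMem (h2 k hk.1 hk.2 h), map_zero]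
    · exact cAnn_bAnn_of_notMem h
  · intro k hk
    by_cases h : k ∈ s.2
    · exact cCreate_cAnn_of_mem (h1 k hk h) (by omega)
    · rw [LinearMap.comp_apply, cAnn_basisVec_of_notMem h, map_zero]

theorem rhoLPlus_basisVec_eq_zero {m : ℤ} {s : Config}
    (h1 : ∀ k, k < -m → k ∈ s.1 → k + m ∈ s.1)
    (h2 : ∀ k, -m ≤ k → k < 0 → k ∈ s.1 → -k - m ∉ s.2)
    (h3 : ∀ k, k ≤ 0 → k - m ∈ s.2 → k ∈ s.2) (hm : 1 ≤ m) :
    rhoLPlus m (basisVec s) = 0 := by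
  rw [rhoLPlus_eq, LinearMap.sub_apply, LinearMap.add_apply,
    opSum_basisVec_eq_zero, opSum_basisVec_eq_zero, opSum_basisVec_eq_zero]
  · simp
  · intro k hk
    by_cases h : k - m ∈ s.2
    · exact cCreate_cAnn_of_mem (h3 k hk h) (by omega)
    · rw [LinearMap.comp_apply, cAnn_basisVec_of_notMem h, map_zero]
  · intro k hk
    by_cases h : k ∈ s.1
    · exact cAnn_bAnn_of_notMem (h2 k hk.1 hk.2 h)
    · rw [LinearMap.comp_apply, bAnn_basisVec_of_notMem h, map_zero]
  · intro k hk
    by_cases h : k ∈ s.1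
    · exact bCreate_bAnn_of_mem (h1 k hk h) (by omega)
    · rw [LinearMap.comp_apply, bAnn_basisVec_of_notMem h, map_zero]

/-! ### The operator `T` -/

theorem exists_bound_config (s : Config) :
    ∃ N : ℤ, 0 ≤ N ∧ (∀ k ∈ s.1, -N ≤ k ∧ k ≤ N) ∧ ∀ k ∈ s.2, -N ≤ k ∧ k ≤ N := by
  refine ⟨∑ k ∈ s.1 ∪ s.2, |k|, Finset.sum_nonneg fun k _ => abs_nonneg k, ?_, ?_⟩ <;>
  · intro k hk
    rw [← abs_le]
    exact Finset.single_le_sum (f := fun k : ℤ => |k|) (fun k _ => abs_nonneg k) (by simp [hk])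

theorem kineticT_eq (L : ℝ) : kineticT L = ((2 * Real.pi / L : ℝ) : ℂ) • opSum (1 ≤ ·) fun m =>
    rhoRPlus m ∘ₗ rhoRMinus m + rhoLMinus m ∘ₗ rhoLPlus m :=
  linearMap_ext_basisVec fun s => by
    simp only [kineticT, opSum, linearCombination_basisVec, LinearMap.smul_apply,
      LinearMap.add_apply, LinearMap.comp_apply]

theorem locallyFiniteOps_kineticT : LocallyFiniteOps (1 ≤ ·) fun m =>
    rhoRPlus m ∘ₗ rhoRMinus m + rhoLMinus m ∘ₗ rhoLPlus m := by
  intro s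
  obtain ⟨N, hN, h1, h2⟩ := exists_bound_config s
  -- With all modes in `[-N, N]`, the last terms to survive are the pair annihilations: their two
  -- modes add up to `m` or to `-m`, which forces `m ≤ 2N`.
  refine ⟨Finset.Icc 1 (2 * N), fun m hm h => ?_⟩
  by_contra hmN
  rw [Finset.mem_Icc, not_and] at hmN
  replace hmN := hmN hm
  refine h ?_
  rw [LinearMap.add_apply, LinearMap.comp_apply, LinearMap.comp_apply, rhoRMinus_basisVec_eq_zero,
    rhoLPlus_basisVec_eq_zero, map_zero, map_zero, add_zero]
  · intro k hk hks; have := h1 k hks; omega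
  · intro k hk hk' hks hks'; have := h1 k hks; have := h2 _ hks'; omega
  · intro k hk hks; have := h2 _ hks; omega
  · exact hm
  · intro k hk hks; have := h2 k hks; omega
  · intro k hk hk' hks hks'; have := h2 k hks; have := h1 _ hks'; omega
  · intro k hk hks; have := h1 _ hks; omega
  · exact hm

/-- By the adjoint relations each summand is `A†A`, so the expectation is a sum of squared norms.
Equality with a real `r` in `ℂ` records reality as well as positivity. -/
theorem inner_kineticT (L : ℝ) (hL : 0 < L) (x : AlgFock) :
    ∃ r : ℝ, 0 ≤ r ∧ inner ℂ (toFock x) (toFock (kineticT L x)) = r := by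
  classical
  obtain ⟨F, hF⟩ := locallyFiniteOps_kineticT.exists_opSum_eq x
  refine ⟨2 * Real.pi / L * ∑ m ∈ F, if 1 ≤ m then
    ‖toFock (rhoRMinus m x)‖ ^ 2 + ‖toFock (rhoLPlus m x)‖ ^ 2 else 0, ?_, ?_⟩
  · have := Real.pi_pos
    refine mul_nonneg (by positivity) (Finset.sum_nonneg fun m _ => ?_)
    split_ifs <;> positivity
  · rw [kineticT_eq, LinearMap.smul_apply, hF F subset_rfl, map_smul, inner_smul_right, map_sum,
      inner_sum]
    push_cast
    congr 1
    refine Finset.sum_congr rfl fun m _ => ?_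
    rw [finsum_eq_if]
    split_ifs
    · rw [LinearMap.add_apply, LinearMap.comp_apply, LinearMap.comp_apply, map_add, inner_add_right,
        ← (formalAdjoint_rhoR m).symm, ← (formalAdjoint_rhoL m).symm, inner_self_eq_norm_sq_to_K,
        inner_self_eq_norm_sq_to_K]
      simp
    · simp

/-- The axial term is kept exactly, since the oscillator bound consumes it; of `T` only the sign is
retained. -/
theorem inner_potentialPart (L a : ℝ) (hL : 0 < L) (x : AlgFock) :
    ∃ r : ℝ, 0 ≤ r ∧ inner ℂ (toFock x) (toFock (potentialPart L a x))
      = ((Real.pi / (2 * L) * ∑ s ∈ x.support, axialRegNumber L a s ^ 2 * ‖x s‖ ^ 2 + r : ℝ) : ℂ) := by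
  obtain ⟨r, hr, h⟩ := inner_kineticT L hL x
  refine ⟨r, hr, ?_⟩
  rw [potentialPart, LinearMap.add_apply, LinearMap.smul_apply, map_add, map_smul, inner_add_right,
    inner_smul_right, h, inner_toFock]
  push_cast
  congr 2
  refine Finset.sum_congr rfl fun s _ => ?_
  rw [Function.comp_apply, axialChargeReg_apply, axialChargeReg_apply, ← Complex.conj_mul']
  ring

/-! ### The unexcited states -/

/-- The occupation pattern of `Ω_P`. -/
def unexcitedConfig (P : ℤ) : Config :=
  if 0 ≤ P then (Finset.Ico 0 P, Finset.Ioc (-P) 0) else (Finset.Ico P 0, Finset.Ioc 0 (-P))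

theorem unexcited_eq (P : ℤ) : unexcited P = basisVec (unexcitedConfig P) := by
  unfold unexcited unexcitedConfig; split_ifs <;> rfl

/-- The number of fermions is `|P|`, and mode `-1` is occupied by a fermion exactly when `P < 0`. -/
theorem unexcitedConfig_injective : Function.Injective unexcitedConfig := by
  intro P Q h
  have hc := congrArg (fun s : Config => (s.1.card : ℤ)) h
  have h0 := congrArg (fun s : Config => (-1 : ℤ) ∈ s.1) h
  simp only [unexcitedConfig] at hc h0
  split_ifs at hc h0 <;> simp at hc h0 <;> omega

theorem axialNumber_unexcitedConfig (P : ℤ) : axialNumber (unexcitedConfig P) = 2 * P := by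
  unfold axialNumber unexcitedConfig
  split_ifs with h
  · have e1 : (Finset.Ico 0 P).filter (0 ≤ ·) = Finset.Ico 0 P :=
      Finset.filter_true_of_mem fun x hx => (Finset.mem_Ico.1 hx).1
    have e2 : (Finset.Ico 0 P).filter (· < 0) = ∅ :=
      Finset.filter_false_of_mem fun x hx => not_lt.2 (Finset.mem_Ico.1 hx).1
    have e3 : (Finset.Ioc (-P) 0).filter (0 < ·) = ∅ :=
      Finset.filter_false_of_mem fun x hx => not_lt.2 (Finset.mem_Ioc.1 hx).2
    have e4 : (Finset.Ioc (-P) 0).filter (· ≤ 0) = Finset.Ioc (-P) 0 :=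
      Finset.filter_true_of_mem fun x hx => (Finset.mem_Ioc.1 hx).2
    simp only [e1, e2, e3, e4, Int.card_Ico, Int.card_Ioc, Finset.card_empty]; omega
  · have e1 : (Finset.Ico P 0).filter (0 ≤ ·) = ∅ :=
      Finset.filter_false_of_mem fun x hx => not_le.2 (Finset.mem_Ico.1 hx).2
    have e2 : (Finset.Ico P 0).filter (· < 0) = Finset.Ico P 0 :=
      Finset.filter_true_of_mem fun x hx => (Finset.mem_Ico.1 hx).2
    have e3 : (Finset.Ioc 0 (-P)).filter (0 < ·) = Finset.Ioc 0 (-P) :=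
      Finset.filter_true_of_mem fun x hx => (Finset.mem_Ioc.1 hx).1
    have e4 : (Finset.Ioc 0 (-P)).filter (· ≤ 0) = ∅ :=
      Finset.filter_false_of_mem fun x hx => not_le.2 (Finset.mem_Ioc.1 hx).1
    simp only [e1, e2, e3, e4, Int.card_Ico, Int.card_Ioc, Finset.card_empty]; omega

/-- The occupied modes form blocks that start at the edge of the spectrum, so every hop made by
`ϱ^R(-m)` or `ϱ^L(m)` is blocked, and no pair of the right chirality is present to be annihilated.
-/
theorem kineticT_unexcited (L : ℝ) (P : ℤ) : kineticT L (unexcited P) = 0 := by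
  rw [unexcited_eq, kineticT_eq, LinearMap.smul_apply, opSum_basisVec_eq_zero, smul_zero]
  intro m hm
  rw [LinearMap.add_apply, LinearMap.comp_apply, LinearMap.comp_apply, rhoRMinus_basisVec_eq_zero,
    rhoLPlus_basisVec_eq_zero, map_zero, map_zero, add_zero]
  all_goals first
  | exact hm
  | unfold unexcitedConfig
    split_ifs <;> simp only [Finset.mem_Ico, Finset.mem_Ioc] <;> omega

theorem potentialPart_unexcited (L a : ℝ) (P : ℤ) : potentialPart L a (unexcited P)
    = ((Real.pi / (2 * L) * (2 * P - (a * L / Real.pi + 1)) ^ 2 : ℝ) : ℂ) • unexcited P := by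
  rw [potentialPart, LinearMap.add_apply, kineticT_unexcited, LinearMap.smul_apply,
    LinearMap.comp_apply, unexcited_eq, axialChargeReg_basisVec, map_smul, axialChargeReg_basisVec,
    smul_smul, smul_smul, add_zero, axialRegNumber, axialNumber_unexcitedConfig]
  congr 1
  push_cast
  ring

theorem unexcited_mem_zeroCharge (P : ℤ) : unexcited P ∈ zeroCharge := by
  rw [unexcited_eq, basisVec, zeroCharge]
  refine Finsupp.single_mem_supported ℂ 1 ?_
  simp only [Set.mem_ofPred_eq, unexcitedConfig]
  split_ifs <;> simp

theorem gaugePerm_unexcitedConfig (P : ℤ) :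
    gaugePerm (unexcitedConfig (P + 1)) = unexcitedConfig P := by
  unfold unexcitedConfig
  split_ifs <;> ext x <;> simp only [gaugePerm, Equiv.coe_fn_mk, Finset.mem_union,
    mem_image_sub_one, mem_image_add_one, Finset.mem_erase, mem_ite_singleton, Finset.mem_Ico,
    Finset.mem_Ioc] <;> omega

/-- The two counts in the exponent are equal for `P ≥ 0` and both zero for `P < 0`, so the exponent
is always even. -/
theorem gaugeSign_unexcitedConfig (P : ℤ) : gaugeSign (unexcitedConfig P) = 1 := by
  unfold gaugeSign unexcitedConfig
  split_ifs with h1 h2 h3 h4 h5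
  · have e1 : (Finset.Ico 0 P).filter (0 < ·) = Finset.Ioo 0 P := by
      ext x; simp only [Finset.mem_filter, Finset.mem_Ico, Finset.mem_Ioo]; omega
    have e2 : (Finset.Ioc (-P) 0).filter (· < 0) = Finset.Ioo (-P) 0 := by
      ext x; simp only [Finset.mem_filter, Finset.mem_Ioc, Finset.mem_Ioo]; omega
    simp only [e1, e2, Int.card_Ioo]
    rw [sub_neg_eq_add, zero_add, sub_zero, pow_add, ← mul_pow]; simp
  · simp only [Finset.mem_Ico, Finset.mem_Ioc] at h2 h3; omega
  · rfl
  · have e1 : (Finset.Ico P 0).filter (0 < ·) = ∅ :=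
      Finset.filter_false_of_mem fun x hx => not_lt.2 (Finset.mem_Ico.1 hx).2.le
    have e2 : (Finset.Ioc 0 (-P)).filter (· < 0) = ∅ :=
      Finset.filter_false_of_mem fun x hx => not_lt.2 (Finset.mem_Ioc.1 hx).1.le
    simp [e1, e2]
  · simp only [Finset.mem_Ico, Finset.mem_Ioc] at h4 h5; omega
  · rfl

theorem gauge_unexcited (P : ℤ) : gauge (toFock (unexcited (P + 1))) = toFock (unexcited P) := by
  rw [gauge_toFock, unexcited_eq, unexcited_eq, gaugeAlg, linearCombination_basisVec,
    gaugeSign_unexcitedConfig, gaugePerm_unexcitedConfig, one_smul]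

theorem gauge_symm_unexcited (P : ℤ) :
    gauge.symm (toFock (unexcited P)) = toFock (unexcited (P + 1)) := by
  rw [← gauge_unexcited, LinearIsometryEquiv.symm_apply_apply]

/-! ### The lower bound -/

theorem hasSum_norm_sq (x : Fock) : HasSum (fun s => ‖x s‖ ^ 2) (‖x‖ ^ 2) := by
  simpa using lp.hasSum_norm (p := 2) (by simp) x

/-- Parseval in `ENNReal`, where sums over `s` and integrals over `a` can be exchanged without
summability hypotheses. -/
theorem ofReal_mul_norm_sq {c : ℝ} (hc : 0 ≤ c) (x : Fock) :
    ENNReal.ofReal (c * ‖x‖ ^ 2) = ∑' s, ENNReal.ofReal (c * ‖x s‖ ^ 2) := by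
  have h := (hasSum_norm_sq x).mul_left c
  rw [← h.tsum_eq, ENNReal.ofReal_tsum_of_nonneg (fun s => by positivity) h.summable]

theorem hasDerivAt_coord {ψ : ℝ → Fock} {ψ' : Fock} {a : ℝ} (h : HasDerivAt ψ ψ' a) (s : Config) :
    HasDerivAt (fun a => ψ a s) (ψ' s) a :=
  ((lp.evalCLM ℝ (fun _ : Config => ℂ) 2 s).hasFDerivAt.comp_hasDerivAt a h :)

theorem continuous_coord {ψ : ℝ → Fock} (h : Continuous ψ) (s : Config) :
    Continuous fun a => ψ a s :=
  (lp.evalCLM ℝ (fun _ : Config => ℂ) 2 s).continuous.comp h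

theorem period_pos {L : ℝ} (hL : 0 < L) : 0 < 2 * Real.pi / L := by
  have := Real.pi_pos; positivity

theorem integral_circleMeasure {E : Type*} [NormedAddCommGroup E] [NormedSpace ℝ E] {L : ℝ}
    (hL : 0 < L) (f : ℝ → E) :
    ∫ a, f a ∂circleMeasure L = ∫ a in (0 : ℝ)..(2 * Real.pi / L), f a := by
  rw [circleMeasure, integral_Icc_eq_integral_Ioc, intervalIntegral.integral_of_le
    (period_pos hL).le]

theorem integrable_circleMeasure {E : Type*} [NormedAddCommGroup E] {f : ℝ → E}
    (hf : Continuous f) (L : ℝ) : Integrable f (circleMeasure L) :=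
  hf.continuousOn.integrableOn_Icc

/-- A form of the harmonic oscillator inequality on an interval, with boundary terms. -/
theorem oscillator_bound {e L : ℝ} (hL : 0 < L) (q : ℝ) {u u' : ℝ → ℂ}
    (hu : ∀ a, HasDerivAt u (u' a) a) (hc : Continuous u') :
    groundEnergy e * ∫ a, ‖u a‖ ^ 2 ∂circleMeasure L
        + (e * √Real.pi / (2 * L)) * ((q - (2 * Real.pi / L * L / Real.pi + 1))
            * ‖u (2 * Real.pi / L)‖ ^ 2)
        - (e * √Real.pi / (2 * L)) * ((q - (0 * L / Real.pi + 1)) * ‖u 0‖ ^ 2)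
      ≤ (∫ a, e ^ 2 / (2 * L) * ‖u' a‖ ^ 2 ∂circleMeasure L)
        + ∫ a, Real.pi / (2 * L) * ((q - (a * L / Real.pi + 1)) ^ 2 * ‖u a‖ ^ 2)
            ∂circleMeasure L := by
  have hpi := Real.pi_pos
  have hcu : Continuous u := continuous_iff_continuousAt.2 fun a => (hu a).continuousAt
  set g : ℝ → ℝ := fun a => (e * √Real.pi / (2 * L)) * ((q - (a * L / Real.pi + 1)) * ‖u a‖ ^ 2)
    with hg
  set g' : ℝ → ℝ := fun a => (e * √Real.pi / (2 * L)) * (-(L / Real.pi) * ‖u a‖ ^ 2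
    + (q - (a * L / Real.pi + 1)) * (2 * inner ℝ (u a) (u' a))) with hg'
  have hgd : ∀ a, HasDerivAt g (g' a) a := fun a => by
    have h1 : HasDerivAt (fun a : ℝ => q - (a * L / Real.pi + 1)) (-(L / Real.pi)) a := by
      have := ((((hasDerivAt_id a).mul_const L).div_const Real.pi).add_const 1).const_sub q
      simpa using this
    exact (h1.mul (hu a).norm_sq).const_mul _
  have hgc : Continuous g' := by
    have : Continuous fun a => inner ℝ (u a) (u' a) := hcu.inner hc
    fun_prop
  have h_int : ∫ a, g' a ∂circleMeasure L = g (2 * Real.pi / L) - g 0 := by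
    rw [integral_circleMeasure hL]
    exact intervalIntegral.integral_eq_sub_of_hasDerivAt (fun a _ => hgd a)
      (hgc.intervalIntegrable _ _)
  have hmono : ∫ a, (groundEnergy e * ‖u a‖ ^ 2 + g' a) ∂circleMeasure L
      ≤ ∫ a, (e ^ 2 / (2 * L) * ‖u' a‖ ^ 2
        + Real.pi / (2 * L) * ((q - (a * L / Real.pi + 1)) ^ 2 * ‖u a‖ ^ 2)) ∂circleMeasure L := by
    refine integral_mono (integrable_circleMeasure (by fun_prop) L)
      (integrable_circleMeasure (by fun_prop) L) fun a => ?_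
    -- Completing the square: with `w = q - (aL/π + 1)`, the right integrand minus the left one is
    -- exactly `(1/2L) |e u' - √π w u|²`. The term `-(L/π)|u|²` in `g'` combines with `E₀|u|²` to
    -- zero, by `hE`.
    have key := norm_sub_sq_real (e • u' a) ((√Real.pi * (q - (a * L / Real.pi + 1))) • u a)
    rw [norm_smul, norm_smul, inner_smul_left, inner_smul_right, real_inner_comm, mul_pow, mul_pow,
      Real.norm_eq_abs, Real.norm_eq_abs, sq_abs, sq_abs, mul_pow, Real.sq_sqrt hpi.le] at key
    have h0 := sq_nonneg ‖e • u' a - (√Real.pi * (q - (a * L / Real.pi + 1))) • u a‖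
    rw [key] at h0
    have hE : groundEnergy e = e * √Real.pi / (2 * L) * (L / Real.pi) := by
      rw [groundEnergy]
      have : √Real.pi ≠ 0 := by positivity
      field_simp
      rw [Real.sq_sqrt hpi.le]
    have h1 : 0 ≤ (1 / (2 * L)) * _ := mul_nonneg (by positivity) h0
    simp only [hg', hE]
    simp only [conj_trivial] at h1
    rw [← sub_nonneg]
    refine h1.trans_eq ?_
    field_simp
    ring
  rw [integral_add (integrable_circleMeasure (by fun_prop) L) (integrable_circleMeasure hgc L),
    integral_add (integrable_circleMeasure (by fun_prop) L)
      (integrable_circleMeasure (by fun_prop) L), integral_const_mul, h_int] at hmono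
  simp only [hg] at hmono
  linarith

theorem ofReal_eq_ofReal_max (z : ℝ) : ENNReal.ofReal z = ENNReal.ofReal (max z 0) := by
  rcases le_total 0 z with hz | hz
  · rw [max_eq_left hz]
  · rw [max_eq_right hz, ENNReal.ofReal_of_nonpos hz, ENNReal.ofReal_zero]

/-- Signed boundary terms are split into positive and negative parts and placed on the sides where
they enter with a plus sign, so that the inequality can be summed in `ENNReal`. -/
theorem ofReal_add_le_of_le {a b c x y : ℝ} (ha : 0 ≤ a) (hb : 0 ≤ b) (hc : 0 ≤ c)
    (h : c + x - y ≤ a + b) :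
    ENNReal.ofReal c + (ENNReal.ofReal x + ENNReal.ofReal (-y))
      ≤ ENNReal.ofReal a + ENNReal.ofReal b + (ENNReal.ofReal (-x) + ENNReal.ofReal y) := by
  rw [ofReal_eq_ofReal_max x, ofReal_eq_ofReal_max y, ofReal_eq_ofReal_max (-x),
    ofReal_eq_ofReal_max (-y), ← ENNReal.ofReal_add (by positivity) (by positivity),
    ← ENNReal.ofReal_add (by positivity) (by positivity),
    ← ENNReal.ofReal_add (by positivity) (by positivity),
    ← ENNReal.ofReal_add (by positivity) (by positivity),
    ← ENNReal.ofReal_add (by positivity) (by positivity)]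
  refine ENNReal.ofReal_le_ofReal ?_
  rcases le_total 0 x with hx | hx <;> rcases le_total 0 y with hy | hy <;>
    simp [hx, hy] <;> linarith

theorem gauge_symm_apply (x : Fock) (s : Config) :
    gauge.symm x s = gaugeSign s * x (gaugePerm s) := rfl

/-- The harmonic oscillator bound, summed over all coordinates. -/
theorem oscillator_bound_lintegral {e L : ℝ} (he : 0 < e) (hL : 0 < L) {Ψ : ℝ → AlgFock}
    (hΨ : IsInDomain L Ψ) :
    ENNReal.ofReal (groundEnergy e * ∫ a, ‖toFock (Ψ a)‖ ^ 2 ∂circleMeasure L)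
      ≤ (∫⁻ a, ENNReal.ofReal (e ^ 2 / (2 * L) * ‖deriv (fun a => toFock (Ψ a)) a‖ ^ 2)
          ∂circleMeasure L)
        + ∫⁻ a, ∑' s, ENNReal.ofReal (Real.pi / (2 * L) * (axialRegNumber L a s ^ 2 * ‖Ψ a s‖ ^ 2))
          ∂circleMeasure L := by
  have hpi := Real.pi_pos
  obtain ⟨-, hsm, hper⟩ := hΨ
  set ψ : ℝ → Fock := fun a => toFock (Ψ a) with hψ
  have hψs : ∀ a s, Ψ a s = ψ a s := fun a s => (toFock_apply _ _).symm
  have hd : ∀ a, HasDerivAt ψ (deriv ψ a) a := fun a =>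
    (hsm.differentiable (by simp) a).hasDerivAt
  have hc : Continuous ψ := hsm.continuous
  have hc' : Continuous (deriv ψ) := hsm.continuous_deriv (by simp)
  have hE : 0 ≤ groundEnergy e := by unfold groundEnergy; positivity
  have hcs := continuous_coord hc
  have hcs' := continuous_coord hc'
  have hw : ∀ s, Continuous fun a => axialRegNumber L a s := fun s => by
    unfold axialRegNumber; fun_prop
  -- `d s` is the boundary term of coordinate `s` at `a = 0`. Twisted periodicity and the change of
  -- charge by 2 make the one at `2π/L` equal to `d (gaugePerm s)`.
  set d : Config → ℝ := fun s =>
    (e * √Real.pi / (2 * L)) * (axialRegNumber L 0 s * ‖Ψ 0 s‖ ^ 2) with hdd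
  have hds : ∀ s ∉ (Ψ 0).support, d s = 0 := fun s hs => by
    simp [hdd, Finsupp.notMem_support_iff.1 hs]
  have hbd : ∀ s, groundEnergy e * ∫ a, ‖ψ a s‖ ^ 2 ∂circleMeasure L + d (gaugePerm s) - d s
      ≤ (∫ a, e ^ 2 / (2 * L) * ‖deriv ψ a s‖ ^ 2 ∂circleMeasure L)
        + ∫ a, Real.pi / (2 * L) * (axialRegNumber L a s ^ 2 * ‖ψ a s‖ ^ 2)
            ∂circleMeasure L := fun s => by
    have h := oscillator_bound (e := e) hL (axialNumber s) (fun a => hasDerivAt_coord (hd a) s)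
      (hcs' s)
    have h1 : ‖ψ (2 * Real.pi / L) s‖ = ‖Ψ 0 (gaugePerm s)‖ := by
      have := hper 0
      rw [zero_add] at this
      rw [hψ]
      simp only [this, gauge_symm_apply, norm_mul, norm_gaugeSign, one_mul, toFock_apply]
    have h2 : (axialNumber s : ℝ) - (2 * Real.pi / L * L / Real.pi + 1)
        = axialRegNumber L 0 (gaugePerm s) := by
      rw [axialRegNumber, axialNumber_gaugePerm]
      push_cast
      field_simp
      ring
    rw [h1, h2, hψs] at h
    simp only [hdd, hψs]
    exact h
  have hsum : ENNReal.ofReal (groundEnergy e * ∫ a, ‖ψ a‖ ^ 2 ∂circleMeasure L)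
      = ∑' s, ENNReal.ofReal (groundEnergy e * ∫ a, ‖ψ a s‖ ^ 2 ∂circleMeasure L) := by
    simp_rw [← integral_const_mul]
    rw [ofReal_integral_eq_lintegral_ofReal (integrable_circleMeasure (by fun_prop) L)
      (ae_of_all _ fun a => by positivity)]
    simp_rw [ofReal_mul_norm_sq hE]
    rw [lintegral_tsum fun s => by have := hcs s; fun_prop]
    refine tsum_congr fun s => ?_
    have := hcs s
    rw [ofReal_integral_eq_lintegral_ofReal (integrable_circleMeasure (by fun_prop) L)
      (ae_of_all _ fun a => by positivity)]
  have hA : (∫⁻ a, ENNReal.ofReal (e ^ 2 / (2 * L) * ‖deriv ψ a‖ ^ 2) ∂circleMeasure L)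
      = ∑' s, ENNReal.ofReal (∫ a, e ^ 2 / (2 * L) * ‖deriv ψ a s‖ ^ 2 ∂circleMeasure L) := by
    simp_rw [ofReal_mul_norm_sq (by positivity : 0 ≤ e ^ 2 / (2 * L))]
    rw [lintegral_tsum fun s => by have := hcs' s; fun_prop]
    refine tsum_congr fun s => ?_
    have := hcs' s
    rw [ofReal_integral_eq_lintegral_ofReal (integrable_circleMeasure (by fun_prop) L)
      (ae_of_all _ fun a => by positivity)]
  have hB : (∫⁻ a, ∑' s, ENNReal.ofReal (Real.pi / (2 * L) * (axialRegNumber L a s ^ 2 * ‖Ψ a s‖ ^ 2))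
          ∂circleMeasure L)
      = ∑' s, ENNReal.ofReal (∫ a, Real.pi / (2 * L) * (axialRegNumber L a s ^ 2 * ‖ψ a s‖ ^ 2)
          ∂circleMeasure L) := by
    simp_rw [hψs]
    rw [lintegral_tsum fun s => by have := hcs s; have := hw s; fun_prop]
    refine tsum_congr fun s => ?_
    have := hcs s
    have := hw s
    rw [ofReal_integral_eq_lintegral_ofReal (integrable_circleMeasure (by fun_prop) L)
      (ae_of_all _ fun a => by positivity)]
  -- Finite because `Ψ 0` is a finite particle vector: only finitely many `d s` are nonzero.
  have hfin : ∀ c : ℝ, ∑' s, ENNReal.ofReal (c * d s) ≠ ⊤ := fun c => by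
    rw [tsum_eq_sum (s := (Ψ 0).support) fun s hs => by simp [hds s hs]]
    exact ENNReal.sum_ne_top.2 fun s _ => ENNReal.ofReal_ne_top
  have hfp : ∑' s, ENNReal.ofReal (d s) ≠ ⊤ := by simpa using hfin 1
  have hfn : ∑' s, ENNReal.ofReal (-d s) ≠ ⊤ := by simpa using hfin (-1)
  have htot := ENNReal.tsum_le_tsum fun s => ofReal_add_le_of_le
    (integral_nonneg fun a => by positivity) (integral_nonneg fun a => by positivity)
    (mul_nonneg hE (integral_nonneg fun a => by positivity)) (hbd s)
  simp only [ENNReal.tsum_add] at htot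
  -- Reindexing along the permutation makes the boundary contributions on the two sides identical;
  -- being finite, they cancel.
  rw [gaugePerm.tsum_eq fun s => ENNReal.ofReal (d s),
    gaugePerm.tsum_eq fun s => ENNReal.ofReal (-d s), ← hsum, ← hA, ← hB,
    add_comm (∑' s, ENNReal.ofReal (-d s))] at htot
  exact (ENNReal.add_le_add_iff_right (ENNReal.add_ne_top.2 ⟨hfp, hfn⟩)).1 htot

/-! ### Twisted periodicity and the quadratic form of `H₀` -/

theorem deriv_twisted {L : ℝ} {ψ : ℝ → Fock}
    (hper : ∀ a, ψ (a + 2 * Real.pi / L) = gauge.symm (ψ a)) (hd : Differentiable ℝ ψ) (a : ℝ) :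
    deriv ψ (a + 2 * Real.pi / L) = gauge.symm (deriv ψ a) := by
  rw [← deriv_comp_add_const]
  have : (fun a => ψ (a + 2 * Real.pi / L)) = fun a => gauge.symm (ψ a) := funext hper
  rw [this]
  have h := (((gauge.symm.toContinuousLinearEquiv : Fock →L[ℂ] Fock).restrictScalars
    ℝ).hasFDerivAt (x := ψ a)).comp_hasDerivAt a (hd a).hasDerivAt
  exact h.deriv

/-- Integration by parts over a period. -/
theorem integral_inner_deriv_deriv {L : ℝ} (hL : 0 < L) {ψ : ℝ → Fock}
    (hper : ∀ a, ψ (a + 2 * Real.pi / L) = gauge.symm (ψ a)) (hsm : ContDiff ℝ 2 ψ) :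
    ∫ a, inner ℂ (ψ a) (deriv (deriv ψ) a) ∂circleMeasure L
      = ((-∫ a, ‖deriv ψ a‖ ^ 2 ∂circleMeasure L : ℝ) : ℂ) := by
  have hsm' : ContDiff ℝ 1 (deriv ψ) := by
    have h2 : ContDiff ℝ (1 + 1) ψ := hsm
    exact (contDiff_succ_iff_deriv.1 h2).2.2
  have hd : ∀ a, HasDerivAt ψ (deriv ψ a) a := fun a =>
    (hsm.differentiable (by simp) a).hasDerivAt
  have hd' : ∀ a, HasDerivAt (deriv ψ) (deriv (deriv ψ) a) a := fun a =>
    (hsm'.differentiable (by simp) a).hasDerivAt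
  have hc : Continuous ψ := hsm.continuous
  have hc' : Continuous (deriv ψ) := hsm'.continuous
  have hc'' : Continuous (deriv (deriv ψ)) := hsm'.continuous_deriv (by simp)
  have hg := fun a => (hd a).inner ℂ (hd' a)
  have hgc : Continuous fun a => inner ℂ (ψ a) (deriv (deriv ψ) a)
      + inner ℂ (deriv ψ a) (deriv ψ a) := (hc.inner hc'').add (hc'.inner hc')
  have h0 : ∫ a, (inner ℂ (ψ a) (deriv (deriv ψ) a) + inner ℂ (deriv ψ a) (deriv ψ a))
      ∂circleMeasure L = 0 := by
    rw [integral_circleMeasure hL, intervalIntegral.integral_eq_sub_of_hasDerivAt (fun a _ => hg a)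
      (hgc.intervalIntegrable _ _)]
    have h1 := hper 0
    have h2 := deriv_twisted hper (hsm.differentiable (by simp)) 0
    rw [zero_add] at h1 h2
    -- `Γ⁻¹` is unitary, so `⟨ψ, ψ'⟩` takes the same value at both ends of the period.
    rw [h1, h2, LinearIsometryEquiv.inner_map_map, sub_self]
  rw [integral_add (integrable_circleMeasure (hc.inner hc'') L)
    (integrable_circleMeasure (hc'.inner hc') L)] at h0
  rw [eq_neg_of_add_eq_zero_left h0]
  push_cast
  rw [← integral_complex_ofReal]
  congr 2
  ext a
  rw [inner_self_eq_norm_sq_to_K]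
  simp

/-- Isolates the second derivative term, the only one that can fail to be real or nonnegative at a
given `a`; it is controlled only after integration. -/
theorem inner_hamiltonian (e : ℝ) {L : ℝ} (hL : 0 < L) (Ψ : ℝ → AlgFock) (a : ℝ) :
    ∃ r : ℝ, 0 ≤ r ∧ inner ℂ (toFock (Ψ a)) (hamiltonian e L Ψ a)
      = ((-(e ^ 2 / (2 * L)) : ℝ) : ℂ)
          * inner ℂ (toFock (Ψ a)) (deriv (deriv fun a => toFock (Ψ a)) a)
        + ((Real.pi / (2 * L) * ∑ s ∈ (Ψ a).support, axialRegNumber L a s ^ 2 * ‖Ψ a s‖ ^ 2 + r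
          : ℝ) : ℂ) := by
  obtain ⟨r, hr, h⟩ := inner_potentialPart L a hL (Ψ a)
  refine ⟨r, hr, ?_⟩
  rw [hamiltonian, inner_add_right, inner_smul_right, h]
  push_cast
  rfl

theorem ofReal_sum_axialRegNumber {L : ℝ} (hL : 0 < L) (a : ℝ) (x : AlgFock) :
    ENNReal.ofReal (Real.pi / (2 * L) * ∑ s ∈ x.support, axialRegNumber L a s ^ 2 * ‖x s‖ ^ 2)
      = ∑' s, ENNReal.ofReal (Real.pi / (2 * L) * (axialRegNumber L a s ^ 2 * ‖x s‖ ^ 2)) := by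
  have := Real.pi_pos
  rw [tsum_eq_sum (s := x.support) fun s hs => by simp [Finsupp.notMem_support_iff.1 hs],
    Finset.mul_sum, ENNReal.ofReal_sum_of_nonneg fun s _ => by positivity]

/-- The form of `F ≥ G + V` that survives in `ENNReal`: negative parts change sides, and the
contribution `r` of `T` is dropped. -/
theorem ofReal_decomposition {F G V r : ℝ} (hV : 0 ≤ V) (hr : 0 ≤ r) (h : F = G + (V + r)) :
    ENNReal.ofReal (-F) + (ENNReal.ofReal G + ENNReal.ofReal V)
      ≤ ENNReal.ofReal F + ENNReal.ofReal (-G) := by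
  rw [ofReal_eq_ofReal_max F, ofReal_eq_ofReal_max G, ofReal_eq_ofReal_max (-F),
    ofReal_eq_ofReal_max (-G), ← ENNReal.ofReal_add (by positivity) (by positivity),
    ← ENNReal.ofReal_add (by positivity) (by positivity),
    ← ENNReal.ofReal_add (by positivity) (by positivity)]
  refine ENNReal.ofReal_le_ofReal ?_
  rcases le_total 0 F with hx | hx <;> rcases le_total 0 G with hy | hy <;>
    simp [hx, hy] <;> linarith

/-- `⟨Ψ, H₀Ψ⟩ ≥ E₀ ‖Ψ‖²` on `𝓓`, with the left side in `(-∞, ∞]`. -/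
theorem groundEnergy_le_lintegral {e L : ℝ} (he : 0 < e) (hL : 0 < L) {Ψ : ℝ → AlgFock}
    (hΨ : IsInDomain L Ψ) :
    (∫⁻ a, ENNReal.ofReal (-(inner ℂ (toFock (Ψ a)) (hamiltonian e L Ψ a)).re)
        ∂circleMeasure L) < ⊤ ∧
      ENNReal.ofReal (groundEnergy e * ∫ a, ‖toFock (Ψ a)‖ ^ 2 ∂circleMeasure L)
        + (∫⁻ a, ENNReal.ofReal (-(inner ℂ (toFock (Ψ a)) (hamiltonian e L Ψ a)).re)
            ∂circleMeasure L)
        ≤ ∫⁻ a, ENNReal.ofReal (inner ℂ (toFock (Ψ a)) (hamiltonian e L Ψ a)).re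
            ∂circleMeasure L := by
  have hpi := Real.pi_pos
  have hosc := oscillator_bound_lintegral he hL hΨ
  obtain ⟨-, hsm, hper⟩ := hΨ
  set ψ : ℝ → Fock := fun a => toFock (Ψ a) with hψ
  have hsm2 : ContDiff ℝ 2 ψ := contDiff_infty.1 hsm 2
  have hc : Continuous ψ := hsm.continuous
  have hc' : Continuous (deriv ψ) := hsm.continuous_deriv (by simp)
  have hc'' : Continuous (deriv (deriv ψ)) := by
    have h2 : ContDiff ℝ (1 + 1) ψ := hsm2
    exact (contDiff_succ_iff_deriv.1 h2).2.2.continuous_deriv (by simp)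
  set F : ℝ → ℝ := fun a => (inner ℂ (toFock (Ψ a)) (hamiltonian e L Ψ a)).re with hF
  set G : ℝ → ℝ := fun a => -(e ^ 2 / (2 * L)) * (inner ℂ (ψ a) (deriv (deriv ψ) a)).re with hG
  set V : ℝ → ℝ := fun a =>
    Real.pi / (2 * L) * ∑ s ∈ (Ψ a).support, axialRegNumber L a s ^ 2 * ‖Ψ a s‖ ^ 2 with hV
  have hV0 : ∀ a, 0 ≤ V a := fun a =>
    mul_nonneg (by positivity) (Finset.sum_nonneg fun s _ => by positivity)
  have hdec : ∀ a, ∃ r, 0 ≤ r ∧ F a = G a + (V a + r) := fun a => by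
    obtain ⟨r, hr, h⟩ := inner_hamiltonian e hL Ψ a
    refine ⟨r, hr, ?_⟩
    simp only [hF, h, Complex.add_re, Complex.re_ofReal_mul, Complex.ofReal_re, hG, hV, hψ]
  have hGc : Continuous G := by
    have : Continuous fun a => inner ℂ (ψ a) (deriv (deriv ψ) a) := hc.inner hc''
    exact continuous_const.mul (Complex.continuous_re.comp this)
  have hGi : Integrable G (circleMeasure L) := integrable_circleMeasure hGc L
  have hGneg : ∫⁻ a, ENNReal.ofReal (-G a) ∂circleMeasure L < ⊤ := hGi.neg.lintegral_lt_top
  have hGpos : ∫⁻ a, ENNReal.ofReal (G a) ∂circleMeasure L < ⊤ := hGi.lintegral_lt_top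
  -- The support of `Ψ a` varies with `a`, so measurability is read off from the sum over all `s`,
  -- whose terms are continuous in `a`.
  have hVm : Measurable fun a => ENNReal.ofReal (V a) := by
    have : (fun a => ENNReal.ofReal (V a)) = fun a => ∑' s, ENNReal.ofReal
        (Real.pi / (2 * L) * (axialRegNumber L a s ^ 2 * ‖ψ a s‖ ^ 2)) := funext fun a => by
      simp only [hV, ofReal_sum_axialRegNumber hL, hψ, toFock_apply]
    rw [this]
    refine Measurable.tsum fun s => ?_
    have h1 := continuous_coord hc s
    have h2 : Continuous fun a => axialRegNumber L a s := by unfold axialRegNumber; fun_prop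
    exact ENNReal.measurable_ofReal.comp (by fun_prop)
  have hVe : (∫⁻ a, ENNReal.ofReal (V a) ∂circleMeasure L) = ∫⁻ a, ∑' s, ENNReal.ofReal
      (Real.pi / (2 * L) * (axialRegNumber L a s ^ 2 * ‖Ψ a s‖ ^ 2)) ∂circleMeasure L :=
    lintegral_congr fun a => ofReal_sum_axialRegNumber hL a (Ψ a)
  have hGint : ∫ a, G a ∂circleMeasure L
      = ∫ a, e ^ 2 / (2 * L) * ‖deriv ψ a‖ ^ 2 ∂circleMeasure L := by
    have h := integral_inner_deriv_deriv hL hper hsm2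
    have h2 := congrArg Complex.re h
    rw [← Complex.reCLM_apply, ← Complex.reCLM.integral_comp_comm
      (integrable_circleMeasure (hc.inner hc'') L), Complex.ofReal_re] at h2
    simp only [Complex.reCLM_apply] at h2
    rw [hG, integral_const_mul, integral_const_mul, h2]
    ring
  -- Integration by parts written as `∫G⁺ = (kinetic energy) + ∫G⁻`, all terms being finite.
  have hG2 : (∫⁻ a, ENNReal.ofReal (G a) ∂circleMeasure L)
      = (∫⁻ a, ENNReal.ofReal (e ^ 2 / (2 * L) * ‖deriv ψ a‖ ^ 2) ∂circleMeasure L)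
        + ∫⁻ a, ENNReal.ofReal (-G a) ∂circleMeasure L := by
    rw [integral_eq_lintegral_pos_part_sub_lintegral_neg_part hGi, sub_eq_iff_eq_add] at hGint
    rw [← ofReal_integral_eq_lintegral_ofReal
      (f := fun a => e ^ 2 / (2 * L) * ‖deriv ψ a‖ ^ 2)
      (integrable_circleMeasure (by fun_prop) L)
      (ae_of_all _ fun a => by positivity), ← ENNReal.ofReal_toReal hGneg.ne,
      ← ENNReal.ofReal_add (integral_nonneg fun a => by positivity) ENNReal.toReal_nonneg, ← hGint,
      ENNReal.ofReal_toReal hGpos.ne]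
  constructor
  -- `F ≥ G` pointwise, so the negative part of `F` is dominated by that of the continuous function
  -- `G`.
  · refine lt_of_le_of_lt (lintegral_mono fun a => ENNReal.ofReal_le_ofReal ?_) hGneg
    obtain ⟨r, hr, h⟩ := hdec a
    have := hV0 a
    change -F a ≤ -G a
    linarith
  · have hle : ∫⁻ a, (ENNReal.ofReal (-F a) + (ENNReal.ofReal (G a) + ENNReal.ofReal (V a)))
        ∂circleMeasure L ≤ ∫⁻ a, (ENNReal.ofReal (F a) + ENNReal.ofReal (-G a)) ∂circleMeasure L :=
      lintegral_mono fun a => by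
        obtain ⟨r, hr, h⟩ := hdec a
        exact ofReal_decomposition (hV0 a) hr h
    have hGm : Measurable fun a => ENNReal.ofReal (G a) := hGc.measurable.ennreal_ofReal
    have hGm' : Measurable fun a => ENNReal.ofReal (-G a) := hGc.neg.measurable.ennreal_ofReal
    have hGV : Measurable fun a => ENNReal.ofReal (G a) + ENNReal.ofReal (V a) := hGm.add hVm
    -- Splitting the integrals requires only the right summands to be measurable. Measurability of
    -- `F`, and with it of the expectation of `T`, is never needed.
    rw [lintegral_add_right _ hGV, lintegral_add_right _ hVm, lintegral_add_right _ hGm',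
      hG2, hVe] at hle
    refine (ENNReal.add_le_add_iff_right hGneg.ne).1 (le_trans ?_ hle)
    calc _ ≤ _ := add_le_add_left (add_le_add_left hosc _) _
      _ = _ := by ring

/-- `H₀ ≥ E₀` as an operator in `𝓚`. -/
theorem groundEnergy_le_of_mem_graph {e L : ℝ} (he : 0 < e) (hL : 0 < L)
    {p : StateSpace L × StateSpace L} (hp : p ∈ hamiltonianGraph e L) :
    (inner ℂ p.1 p.2).im = 0 ∧ groundEnergy e * ‖p.1‖ ^ 2 ≤ (inner ℂ p.1 p.2).re := by
  obtain ⟨Ψ, hΨ, h1, h2⟩ := hp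
  obtain ⟨hfin, hle⟩ := groundEnergy_le_lintegral he hL hΨ
  obtain ⟨-, hsm, hper⟩ := hΨ
  have hsm2 : ContDiff ℝ 2 fun a => toFock (Ψ a) := contDiff_infty.1 hsm 2
  have hc : Continuous fun a => toFock (Ψ a) := hsm.continuous
  have hc'' : Continuous (deriv (deriv fun a => toFock (Ψ a))) := by
    have h2 : ContDiff ℝ (1 + 1) fun a => toFock (Ψ a) := hsm2
    exact (contDiff_succ_iff_deriv.1 h2).2.2.continuous_deriv (by simp)
  have hae : (fun a => inner ℂ (p.1 a) (p.2 a))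
      =ᵐ[circleMeasure L] fun a => inner ℂ (toFock (Ψ a)) (hamiltonian e L Ψ a) := by
    filter_upwards [h1, h2] with a ha1 ha2
    rw [ha1, ha2]
  have h_int : Integrable (fun a => inner ℂ (toFock (Ψ a)) (hamiltonian e L Ψ a))
      (circleMeasure L) := (L2.integrable_inner p.1 p.2).congr hae
  have hE : 0 ≤ groundEnergy e := by have := Real.pi_pos; unfold groundEnergy; positivity
  have hnorm : ‖p.1‖ ^ 2 = ∫ a, ‖toFock (Ψ a)‖ ^ 2 ∂circleMeasure L := by
    have h : ((‖p.1‖ ^ 2 : ℝ) : ℂ) = ((∫ a, ‖toFock (Ψ a)‖ ^ 2 ∂circleMeasure L : ℝ) : ℂ) := by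
      rw [← integral_complex_ofReal]
      push_cast
      have h3 := inner_self_eq_norm_sq_to_K (𝕜 := ℂ) p.1
      rw [L2.inner_def] at h3
      refine h3.symm.trans (integral_congr_ae ?_)
      filter_upwards [h1] with a ha1
      rw [ha1, inner_self_eq_norm_sq_to_K]
      rfl
    exact_mod_cast h
  rw [L2.inner_def, integral_congr_ae hae]
  constructor
  · rw [← Complex.imCLM_apply, ← Complex.imCLM.integral_comp_comm h_int]
    -- Pointwise the imaginary part comes from the second derivative alone; its integral vanishes
    -- because integration by parts gives a real number.
    have h : ∀ a, Complex.imCLM (inner ℂ (toFock (Ψ a)) (hamiltonian e L Ψ a))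
        = -(e ^ 2 / (2 * L)) * Complex.imCLM
          (inner ℂ (toFock (Ψ a)) (deriv (deriv fun a => toFock (Ψ a)) a)) := fun a => by
      obtain ⟨r, -, h⟩ := inner_hamiltonian e hL Ψ a
      simp only [h, Complex.imCLM_apply, Complex.add_im, Complex.im_ofReal_mul, Complex.ofReal_im,
        add_zero]
    simp_rw [h]
    rw [integral_const_mul, Complex.imCLM.integral_comp_comm
      (integrable_circleMeasure (hc.inner hc'') L), integral_inner_deriv_deriv hL hper hsm2,
      Complex.imCLM_apply, Complex.ofReal_im, mul_zero]
  · rw [← Complex.reCLM_apply, ← Complex.reCLM.integral_comp_comm h_int]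
    simp only [Complex.reCLM_apply]
    have hre : Integrable (fun a => (inner ℂ (toFock (Ψ a)) (hamiltonian e L Ψ a)).re)
        (circleMeasure L) := Complex.reCLM.integrable_comp h_int
    rw [integral_eq_lintegral_pos_part_sub_lintegral_neg_part hre, hnorm, le_sub_iff_add_le]
    have hpos := hre.lintegral_lt_top
    have := ENNReal.toReal_mono hpos.ne hle
    rwa [ENNReal.toReal_add ENNReal.ofReal_ne_top hfin.ne, ENNReal.toReal_ofReal
      (mul_nonneg hE (integral_nonneg fun a => by positivity))] at this

section

/-! ### Sums of translates over the unexcited states -/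

/-- The value of `x = a - (2π/L)(P - 1/2)`. -/
def shifted (L a : ℝ) (P : ℤ) : ℝ := a - 2 * Real.pi / L * ((P : ℝ) - 1 / 2)

/-- `∑_P φ(a - (2π/L)(P - 1/2)) Ω_P` -/
def latticeSum (L : ℝ) (φ : ℝ → ℝ) (a : ℝ) : Fock :=
  ∑' P : ℤ, ((φ (shifted L a P) : ℝ) : ℂ) • toFock (unexcited P)

/-- `|φ(x)| ≤ C / (1 + x²)` -/
def Decays (φ : ℝ → ℝ) (C : ℝ) : Prop := ∀ x, |φ x| ≤ C / (1 + x ^ 2)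

theorem Decays.nonneg {φ : ℝ → ℝ} {C : ℝ} (h : Decays φ C) : 0 ≤ C := by
  have := (abs_nonneg _).trans (h 0)
  simpa using this

theorem norm_toFock_unexcited (P : ℤ) : ‖toFock (unexcited P)‖ = 1 := by
  rw [unexcited_eq, norm_toFock_basisVec]

/-- A summable majorant for the translates of `1 / (1 + x²)`. -/
def latticeWeight (L : ℝ) (P : ℤ) : ℝ := 1 / (1 + (shifted L 0 P) ^ 2)

theorem summable_latticeWeight {L : ℝ} (hL : 0 < L) : Summable (latticeWeight L) := by
  have h := (Real.summable_one_div_int_add_rpow (-1 / 2) 2).2 one_lt_two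
  have hl := period_pos hL
  refine Summable.of_nonneg_of_le (fun P => by unfold latticeWeight; positivity) (fun P => ?_)
    (h.mul_left (1 / (2 * Real.pi / L) ^ 2))
  -- The half-integer offset never vanishes, so comparison with `1 / (P - 1/2)²` has no degenerate
  -- term.
  have hP : ((P : ℝ) + -1 / 2) ≠ 0 := fun h0 => by
    have h1 : (2 * P : ℝ) = 1 := by linarith
    have h2 : 2 * P = 1 := by exact_mod_cast h1
    omega
  rw [latticeWeight, shifted, one_div_mul_one_div]
  refine one_div_le_one_div_of_le (by positivity) ?_
  rw [Real.rpow_two, sq_abs]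
  nlinarith [sq_nonneg (2 * Real.pi / L * ((P : ℝ) - 1 / 2))]

/-- From `(x - a)² ≤ 2x² + 2a²`: for bounded `a` the weights at `a` and at `0` are comparable. This
gives one summable majorant, locally uniform in `a` and linear in `C`. -/
theorem Decays.le_latticeWeight {φ : ℝ → ℝ} {C : ℝ} (h : Decays φ C) (L : ℝ) {a R : ℝ}
    (ha : |a| ≤ R) (P : ℤ) :
    |φ (shifted L a P)| ≤ C * (2 * (1 + R ^ 2)) * latticeWeight L P := by
  have hC := h.nonneg
  refine (h _).trans ?_
  rw [latticeWeight, mul_one_div, mul_div_assoc, div_eq_mul_one_div]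
  refine mul_le_mul_of_nonneg_left ?_ hC
  rw [div_le_div_iff₀ (by positivity) (by positivity), one_mul]
  have ha2 : a ^ 2 ≤ R ^ 2 := by rw [← sq_abs a]; gcongr
  have : shifted L 0 P = shifted L a P - a := by unfold shifted; ring
  rw [this]
  nlinarith [sq_nonneg (shifted L a P + a), sq_nonneg (shifted L a P),
    mul_nonneg (sq_nonneg R) (sq_nonneg (shifted L a P))]

theorem norm_latticeSum_term (φ : ℝ → ℝ) (L a : ℝ) (P : ℤ) :
    ‖((φ (shifted L a P) : ℝ) : ℂ) • toFock (unexcited P)‖ = |φ (shifted L a P)| := by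
  rw [norm_smul, norm_toFock_unexcited, mul_one, Complex.norm_real, Real.norm_eq_abs]

variable {L : ℝ} {φ φ' : ℝ → ℝ} {C C' : ℝ}

theorem Decays.summable (h : Decays φ C) (hL : 0 < L) (a : ℝ) :
    Summable fun P : ℤ => ((φ (shifted L a P) : ℝ) : ℂ) • toFock (unexcited P) :=
  .of_norm_bounded ((summable_latticeWeight hL).mul_left (C * (2 * (1 + |a| ^ 2)))) fun P => by
    rw [norm_latticeSum_term]; exact h.le_latticeWeight L le_rfl P

theorem Decays.hasSum (h : Decays φ C) (hL : 0 < L) (a : ℝ) :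
    HasSum (fun P : ℤ => ((φ (shifted L a P) : ℝ) : ℂ) • toFock (unexcited P))
      (latticeSum L φ a) := (h.summable hL a).hasSum

/-- A bound for `latticeSum` over one period. -/
theorem exists_norm_latticeSum_le (hL : 0 < L) : ∃ K : ℝ, 0 ≤ K ∧ ∀ (φ : ℝ → ℝ) (C : ℝ),
    Decays φ C → ∀ a ∈ Set.Icc 0 (2 * Real.pi / L), ‖latticeSum L φ a‖ ≤ C * K := by
  refine ⟨2 * (1 + (2 * Real.pi / L) ^ 2) * ∑' P, latticeWeight L P, ?_, fun φ C h a ha => ?_⟩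
  · exact mul_nonneg (by positivity) (tsum_nonneg fun P => by unfold latticeWeight; positivity)
  · rw [← mul_assoc]
    refine tsum_of_norm_bounded ((summable_latticeWeight hL).hasSum.mul_left _) fun P => ?_
    rw [norm_latticeSum_term]
    exact h.le_latticeWeight L (by rw [abs_of_nonneg ha.1]; exact ha.2) P

/-- Termwise differentiation on the ball of radius `|a| + 1`, where the decay of `φ'` supplies a
summable bound independent of the point. -/
theorem hasDerivAt_latticeSum (hL : 0 < L) (h : Decays φ C) (h' : Decays φ' C')
    (hd : ∀ x, HasDerivAt φ (φ' x) x) (a : ℝ) :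
    HasDerivAt (latticeSum L φ) (latticeSum L φ' a) a := by
  have ha : a ∈ Metric.ball (0 : ℝ) (|a| + 1) := by simp
  refine hasDerivAt_tsum_of_isPreconnected
    (g := fun P y => ((φ (shifted L y P) : ℝ) : ℂ) • toFock (unexcited P))
    (g' := fun P y => ((φ' (shifted L y P) : ℝ) : ℂ) • toFock (unexcited P))
    (u := fun P => C' * (2 * (1 + (|a| + 1) ^ 2)) * latticeWeight L P)
    ((summable_latticeWeight hL).mul_left _) Metric.isOpen_ball
    (convex_ball _ _).isPreconnected (fun P y _ => ?_) (fun P y hy => ?_) ha (h.summable hL a) ha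
  · have h1 : HasDerivAt (fun y => shifted L y P) 1 y := (hasDerivAt_id y).sub_const _
    have h2 := (hd (shifted L y P)).comp y h1
    rw [mul_one] at h2
    exact h2.ofReal_comp.smul_const _
  · rw [norm_latticeSum_term]
    rw [mem_ball_zero_iff, Real.norm_eq_abs] at hy
    exact h'.le_latticeWeight L hy.le P

/-- Advancing `a` by a period and `P` by one leaves the argument of `φ` unchanged, while `Γ⁻¹`
raises `P` by one. No decay is needed, as a continuous linear equivalence commutes with `tsum` in
every case. -/
theorem latticeSum_twisted (L : ℝ) (φ : ℝ → ℝ) (a : ℝ) :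
    latticeSum L φ (a + 2 * Real.pi / L) = gauge.symm (latticeSum L φ a) := by
  have h : gauge.symm (latticeSum L φ a)
      = ∑' P : ℤ, gauge.symm (((φ (shifted L a P) : ℝ) : ℂ) • toFock (unexcited P)) :=
    gauge.symm.toContinuousLinearEquiv.map_tsum
  rw [h, latticeSum, ← (Equiv.addRight (1 : ℤ)).tsum_eq]
  refine tsum_congr fun P => ?_
  rw [map_smul, gauge_symm_unexcited]
  congr 3
  simp only [shifted, Equiv.coe_addRight]
  push_cast
  ring

theorem toFock_mem_zeroChargeFock {x : AlgFock} (hx : x ∈ zeroCharge) :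
    toFock x ∈ zeroChargeFock :=
  Submodule.le_topologicalClosure _ (Submodule.mem_map_of_mem hx)

theorem Decays.latticeSum_mem (h : Decays φ C) (hL : 0 < L) (a : ℝ) :
    latticeSum L φ a ∈ zeroChargeFock := by
  have hcl : IsClosed (zeroChargeFock : Set Fock) := Submodule.isClosed_topologicalClosure _
  refine hcl.mem_of_tendsto (h.hasSum hL a) (Filter.Eventually.of_forall fun F => ?_)
  exact Submodule.sum_mem _ fun P _ => Submodule.smul_mem _ _
    (toFock_mem_zeroChargeFock (unexcited_mem_zeroCharge P))

/-- Parseval: the `Ω_P` are distinct basis vectors, so the coefficients are recovered as inner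
products. -/
theorem Decays.hasSum_norm_sq (h : Decays φ C) (hL : 0 < L) (a : ℝ) :
    HasSum (fun P : ℤ => φ (shifted L a P) ^ 2) (‖latticeSum L φ a‖ ^ 2) := by
  have hs := h.hasSum hL a
  have hin : ∀ P, inner ℂ (latticeSum L φ a) (toFock (unexcited P))
      = ((φ (shifted L a P) : ℝ) : ℂ) := fun P => by
    have h1 := (innerSL ℂ (toFock (unexcited P))).hasSum hs
    have h2 : ∀ Q, innerSL ℂ (toFock (unexcited P))
        (((φ (shifted L a Q) : ℝ) : ℂ) • toFock (unexcited Q))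
        = if Q = P then ((φ (shifted L a P) : ℝ) : ℂ) else 0 := fun Q => by
      rw [innerSL_apply_apply, inner_smul_right, unexcited_eq, unexcited_eq,
        toFock_basisVec (unexcitedConfig P)]
      rw [lp.inner_single_left, toFock_apply, basisVec, Finsupp.single_apply]
      by_cases hQ : Q = P
      · subst hQ; simp
      · simp [hQ, unexcitedConfig_injective.ne hQ]
    simp only [h2] at h1
    have h3 := h1.unique (hasSum_ite_eq P _)
    rw [innerSL_apply_apply] at h3
    rw [← inner_conj_symm, h3, Complex.conj_ofReal]
  have h1 := (innerSL ℂ (latticeSum L φ a)).hasSum hs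
  simp only [innerSL_apply_apply, inner_smul_right, hin, inner_self_eq_norm_sq_to_K] at h1
  have h2 := Complex.reCLM.hasSum h1
  simp only [Complex.reCLM_apply] at h2
  convert h2 using 1
  · ext P; rw [← Complex.ofReal_mul, Complex.ofReal_re, sq]
  · exact (Complex.ofReal_re _).symm.trans (by push_cast; rfl)

/-! ### Integration over a period -/

/-- Unfolding: the translates of one period by `(2π/L)(P - 1/2)` tile the line. -/
theorem lintegral_sum_translates (hL : 0 < L) {g : ℝ → ENNReal} (hg : Measurable g) :
    ∫⁻ a, ∑' P : ℤ, g (shifted L a P) ∂circleMeasure L = ∫⁻ x, g x := by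
  have hl := period_pos hL
  -- The `P`-th translate of `(0, 2π/L]` starts at `π/L - P · 2π/L`; hence the base point `π/L` of
  -- the tiling and the reflection `P ↦ -P` of the index.
  rw [lintegral_tsum fun P => by unfold shifted; exact (hg.comp (by fun_prop)).aemeasurable,
    ← setLIntegral_univ (μ := volume) (f := g), ← iUnion_Ioc_add_zsmul hl (Real.pi / L),
    lintegral_iUnion (fun _ => measurableSet_Ioc) (Set.pairwise_disjoint_Ioc_add_zsmul _ _),
    ← (Equiv.neg ℤ).tsum_eq]
  refine tsum_congr fun P => ?_
  rw [circleMeasure, setLIntegral_congr Ioc_ae_eq_Icc.symm,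
    ← (measurePreserving_sub_right volume (2 * Real.pi / L * (((-P : ℤ) : ℝ) - 1 / 2))
      ).setLIntegral_comp_preimage measurableSet_Ioc hg]
  congr 2
  ext x
  simp only [Set.mem_preimage, Set.mem_Ioc, zsmul_eq_mul]
  push_cast
  have e1 : 2 * Real.pi / L * (-(P : ℝ) - 1 / 2)
    = -(Real.pi / L + P * (2 * Real.pi / L)) := by ring
  rw [e1]
  constructor <;> rintro ⟨h1, h2⟩ <;> constructor <;> linarith

theorem Decays.lintegral_norm_sq (h : Decays φ C) (hc : Continuous φ) (hL : 0 < L) :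
    ∫⁻ a, ENNReal.ofReal (‖latticeSum L φ a‖ ^ 2) ∂circleMeasure L
      = ∫⁻ x, ENNReal.ofReal (φ x ^ 2) := by
  rw [← lintegral_sum_translates hL (g := fun x => ENNReal.ofReal (φ x ^ 2)) (by fun_prop)]
  refine lintegral_congr fun a => ?_
  have hs := h.hasSum_norm_sq hL a
  rw [← hs.tsum_eq, ENNReal.ofReal_tsum_of_nonneg (fun P => sq_nonneg _) hs.summable]

instance (L : ℝ) : IsFiniteMeasure (circleMeasure L) := by
  unfold circleMeasure; infer_instance

theorem memLp_circleMeasure {f : ℝ → Fock} (hf : Continuous f) (L : ℝ) :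
    MemLp f 2 (circleMeasure L) := by
  obtain ⟨K, hK⟩ := (isCompact_Icc (a := (0 : ℝ)) (b := 2 * Real.pi / L)).exists_bound_of_continuousOn
    hf.continuousOn
  exact MemLp.of_bound hf.aestronglyMeasurable K
    ((ae_restrict_iff' measurableSet_Icc).2 (ae_of_all _ hK))

theorem norm_toLp_sq {f : ℝ → Fock} (hf : Continuous f) (L : ℝ) :
    ‖(memLp_circleMeasure hf L).toLp f‖ ^ 2
      = (∫⁻ a, ENNReal.ofReal (‖f a‖ ^ 2) ∂circleMeasure L).toReal := by
  rw [Lp.norm_toLp, eLpNorm_eq_lintegral_rpow_enorm_toReal (by simp) (by simp)]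
  simp only [ENNReal.toReal_ofNat]
  rw [← ENNReal.toReal_pow, ← ENNReal.rpow_natCast, ← ENNReal.rpow_mul]
  norm_num

theorem ae_circleMeasure {p : ℝ → Prop} (h : ∀ a ∈ Set.Icc 0 (2 * Real.pi / L), p a) :
    ∀ᵐ a ∂circleMeasure L, p a :=
  (ae_restrict_iff' measurableSet_Icc).2 (ae_of_all _ h)

/-! ### Linear combinations -/

theorem Decays.add {ψ : ℝ → ℝ} (h : Decays φ C) (h' : Decays ψ C') :
    Decays (fun x => φ x + ψ x) (C + C') := fun x => by
  rw [add_div]; exact (abs_add_le _ _).trans (add_le_add (h x) (h' x))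

theorem Decays.const_mul (h : Decays φ C) (c : ℝ) : Decays (fun x => c * φ x) (|c| * C) :=
  fun x => by rw [abs_mul, mul_div_assoc]; exact mul_le_mul_of_nonneg_left (h x) (abs_nonneg c)

theorem latticeSum_add {ψ : ℝ → ℝ} (hL : 0 < L) (h : Decays φ C) (h' : Decays ψ C') (a : ℝ) :
    latticeSum L (fun x => φ x + ψ x) a = latticeSum L φ a + latticeSum L ψ a := by
  rw [latticeSum, latticeSum, latticeSum, ← (h.summable hL a).tsum_add (h'.summable hL a)]
  refine tsum_congr fun P => ?_
  rw [Complex.ofReal_add, add_smul]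

theorem latticeSum_const_mul (L : ℝ) (φ : ℝ → ℝ) (c a : ℝ) :
    latticeSum L (fun x => c * φ x) a = (c : ℂ) • latticeSum L φ a := by
  rw [latticeSum, latticeSum, ← tsum_const_smul'']
  refine tsum_congr fun P => ?_
  rw [Complex.ofReal_mul, mul_smul]

end

section

/-! ### The Gaussian -/

/-- The constant `L / (√π e)`, so that the Gaussian is a multiple of `exp (-b x² / 2)`. -/
def gaussRate (e L : ℝ) : ℝ := L / (√Real.pi * e)

variable {e L : ℝ}

theorem gaussRate_pos (he : 0 < e) (hL : 0 < L) : 0 < gaussRate e L := by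
  have := Real.pi_pos; unfold gaussRate; positivity

theorem gaussian_eq (e L x : ℝ) : gaussian e L x
    = L ^ (1 / 4 : ℝ) / (Real.pi ^ (3 / 8 : ℝ) * e ^ (1 / 4 : ℝ))
      * Real.exp (-(gaussRate e L * x ^ 2 / 2)) := by
  rw [gaussian, gaussRate]
  congr 2
  rw [neg_div, div_mul_eq_mul_div, div_div]
  congr 2
  ring

theorem gaussian_nonneg (he : 0 < e) (hL : 0 < L) (x : ℝ) : 0 ≤ gaussian e L x := by
  have := Real.pi_pos; unfold gaussian; positivity

theorem hasDerivAt_gaussian (e L x : ℝ) :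
    HasDerivAt (gaussian e L) (-(gaussRate e L) * x * gaussian e L x) x := by
  have h1 : HasDerivAt (fun x : ℝ => -(gaussRate e L * x ^ 2 / 2)) (-(gaussRate e L * x)) x := by
    have := (((hasDerivAt_pow 2 x).const_mul (gaussRate e L)).div_const 2).neg
    exact this.congr_deriv (by simp; ring)
  have h2 := h1.exp.const_mul (L ^ (1 / 4 : ℝ) / (Real.pi ^ (3 / 8 : ℝ) * e ^ (1 / 4 : ℝ)))
  rw [gaussian_eq, funext (gaussian_eq e L)]
  exact h2.congr_deriv (by ring)

theorem hasDerivAt_deriv_gaussian (e L x : ℝ) :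
    HasDerivAt (fun x => -(gaussRate e L) * x * gaussian e L x)
      ((gaussRate e L ^ 2 * x ^ 2 - gaussRate e L) * gaussian e L x) x := by
  have h := ((hasDerivAt_id x).const_mul (-(gaussRate e L))).mul (hasDerivAt_gaussian e L x)
  exact h.congr_deriv (by simp only [id]; ring)

theorem hasDerivAt_deriv_deriv_gaussian (e L x : ℝ) :
    HasDerivAt (fun x => (gaussRate e L ^ 2 * x ^ 2 - gaussRate e L) * gaussian e L x)
      ((3 * gaussRate e L ^ 2 * x - gaussRate e L ^ 3 * x ^ 3) * gaussian e L x) x := by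
  have h := (((hasDerivAt_pow 2 x).const_mul (gaussRate e L ^ 2)).sub_const
    (gaussRate e L)).mul (hasDerivAt_gaussian e L x)
  exact h.congr_deriv (by simp; ring)

theorem contDiff_gaussian (e L : ℝ) : ContDiff ℝ ∞ (gaussian e L) := by
  rw [funext (gaussian_eq e L)]
  fun_prop

theorem exists_gaussian_le (he : 0 < e) (hL : 0 < L) (n : ℕ) :
    ∃ C, 0 ≤ C ∧ ∀ x, gaussian e L x ≤ C / (1 + x ^ 2) ^ n := by
  have hpi := Real.pi_pos
  set b := gaussRate e L with hb
  have hb0 : 0 < b := gaussRate_pos he hL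
  set N := L ^ (1 / 4 : ℝ) / (Real.pi ^ (3 / 8 : ℝ) * e ^ (1 / 4 : ℝ)) with hN
  have hN0 : 0 ≤ N := by positivity
  -- The constant comes from `yⁿ/n! ≤ exp y` at `y = (b/2)(1 + x²)`.
  refine ⟨N * ((2 / b) ^ n * n.factorial * Real.exp (b / 2)), by positivity, fun x => ?_⟩
  rw [gaussian_eq, mul_div_assoc N]
  refine mul_le_mul_of_nonneg_left ?_ hN0
  have h := Real.pow_div_factorial_le_exp (b / 2 * (1 + x ^ 2)) (by positivity) n
  have h1 : Real.exp (b / 2 * (1 + x ^ 2)) = Real.exp (b / 2) / Real.exp (-(b * x ^ 2 / 2)) := by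
    rw [← Real.exp_sub]; congr 1; ring
  rw [h1, div_le_div_iff₀ (by positivity) (by positivity), mul_pow] at h
  rw [le_div_iff₀ (by positivity)]
  have h2 : (2 / b) ^ n * (b / 2) ^ n = 1 := by
    rw [← mul_pow]
    have : 2 / b * (b / 2) = 1 := by field_simp
    rw [this, one_pow]
  calc Real.exp (-(b * x ^ 2 / 2)) * (1 + x ^ 2) ^ n
      = (2 / b) ^ n * ((b / 2) ^ n * (1 + x ^ 2) ^ n * Real.exp (-(b * x ^ 2 / 2))) := by
        rw [← mul_assoc, ← mul_assoc, h2]; ring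
    _ ≤ (2 / b) ^ n * (Real.exp (b / 2) * n.factorial) := by gcongr
    _ = _ := by ring

/-- A polynomially bounded multiple of the Gaussian decays. -/
theorem exists_decays_mul_gaussian (he : 0 < e) (hL : 0 < L) {g : ℝ → ℝ} {A : ℝ} {n : ℕ}
    (hg : ∀ x, |g x| ≤ A * (1 + x ^ 2) ^ n) : ∃ C, Decays (fun x => g x * gaussian e L x) C := by
  obtain ⟨C, hC, h⟩ := exists_gaussian_le he hL (n + 1)
  refine ⟨A * C, fun x => ?_⟩
  rw [abs_mul, abs_of_nonneg (gaussian_nonneg he hL x)]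
  calc |g x| * gaussian e L x ≤ A * (1 + x ^ 2) ^ n * (C / (1 + x ^ 2) ^ (n + 1)) :=
        mul_le_mul (hg x) (h x) (gaussian_nonneg he hL x) ((abs_nonneg _).trans (hg x))
    _ = A * C / (1 + x ^ 2) := by
        have : (1 + x ^ 2) ≠ 0 := by positivity
        field_simp
        ring

theorem abs_le_one_add_sq (x : ℝ) : |x| ≤ 1 + x ^ 2 := by
  rw [← sq_abs]; nlinarith [sq_nonneg (|x| - 1)]

theorem exists_decays_gaussian (he : 0 < e) (hL : 0 < L) : ∃ C, Decays (gaussian e L) C := by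
  simpa using exists_decays_mul_gaussian he hL (g := fun _ => 1) (A := 1) (n := 0) (by simp)

theorem exists_decays_sq_gaussian (he : 0 < e) (hL : 0 < L) :
    ∃ C, Decays (fun x => x ^ 2 * gaussian e L x) C :=
  exists_decays_mul_gaussian he hL (A := 1) (n := 1) fun x => by
    rw [abs_of_nonneg (sq_nonneg x)]; linarith

theorem exists_decays_deriv_gaussian (he : 0 < e) (hL : 0 < L) :
    ∃ C, Decays (fun x => -(gaussRate e L) * x * gaussian e L x) C := by
  have hb := gaussRate_pos he hL
  refine exists_decays_mul_gaussian he hL (A := gaussRate e L) (n := 1) fun x => ?_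
  rw [abs_mul, abs_neg, abs_of_pos hb, pow_one]
  exact mul_le_mul_of_nonneg_left (abs_le_one_add_sq x) hb.le

theorem exists_decays_deriv_deriv_gaussian (he : 0 < e) (hL : 0 < L) :
    ∃ C, Decays (fun x => (gaussRate e L ^ 2 * x ^ 2 - gaussRate e L) * gaussian e L x) C := by
  have hb := gaussRate_pos he hL
  refine exists_decays_mul_gaussian he hL (A := gaussRate e L ^ 2 + gaussRate e L) (n := 1)
    fun x => ?_
  rw [abs_le]
  constructor <;>
    nlinarith [sq_nonneg x, mul_nonneg hb.le (sq_nonneg x), mul_nonneg (sq_nonneg (gaussRate e L))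
      (sq_nonneg x), sq_nonneg (gaussRate e L)]

/-- Used to differentiate the series for `Ψ₀''` once more, which gives its continuity. -/
theorem exists_decays_deriv_deriv_deriv_gaussian (he : 0 < e) (hL : 0 < L) :
    ∃ C, Decays (fun x => (3 * gaussRate e L ^ 2 * x - gaussRate e L ^ 3 * x ^ 3)
      * gaussian e L x) C := by
  have hb := gaussRate_pos he hL
  refine exists_decays_mul_gaussian he hL (A := 3 * gaussRate e L ^ 2 + gaussRate e L ^ 3) (n := 2)
    fun x => ?_
  have h1 := abs_le_one_add_sq x
  have h2 : |x| ≤ (1 + x ^ 2) ^ 2 := by nlinarith [sq_nonneg x]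
  have h3 : |x ^ 3| ≤ (1 + x ^ 2) ^ 2 := by
    have : |x ^ 3| = x ^ 2 * |x| := by rw [abs_pow, ← sq_abs x]; ring
    rw [this]; nlinarith [sq_nonneg x]
  calc _ ≤ |3 * gaussRate e L ^ 2 * x| + |gaussRate e L ^ 3 * x ^ 3| := abs_sub _ _
    _ = 3 * gaussRate e L ^ 2 * |x| + gaussRate e L ^ 3 * |x ^ 3| := by
        rw [abs_mul, abs_mul (_ ^ 3), abs_of_nonneg (by positivity : 0 ≤ 3 * gaussRate e L ^ 2),
          abs_of_nonneg (by positivity : 0 ≤ gaussRate e L ^ 3)]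
    _ ≤ 3 * gaussRate e L ^ 2 * (1 + x ^ 2) ^ 2 + gaussRate e L ^ 3 * (1 + x ^ 2) ^ 2 := by gcongr
    _ = _ := by ring

/-- The oscillator eigenvalue equation for the Gaussian. -/
theorem oscillator_gaussian (he : 0 < e) (hL : 0 < L) (x : ℝ) :
    L / (2 * Real.pi) * (x ^ 2 * gaussian e L x)
      = e ^ 2 / (2 * L) * ((gaussRate e L ^ 2 * x ^ 2 - gaussRate e L) * gaussian e L x)
        + groundEnergy e * gaussian e L x := by
  have hpi := Real.pi_pos
  have hs : √Real.pi ^ 2 = Real.pi := Real.sq_sqrt hpi.le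
  have h1 : e ^ 2 / (2 * L) * gaussRate e L ^ 2 = L / (2 * Real.pi) := by
    rw [gaussRate, div_pow, mul_pow, hs]; field_simp
  have h2 : e ^ 2 / (2 * L) * gaussRate e L = groundEnergy e := by
    have : √Real.pi ≠ 0 := by positivity
    rw [gaussRate, groundEnergy]; field_simp
  rw [← h1, ← h2]; ring

theorem integral_gaussian_sq (he : 0 < e) (hL : 0 < L) :
    Integrable (fun x => gaussian e L x ^ 2) ∧ ∫ x, gaussian e L x ^ 2 = 1 := by
  have hpi := Real.pi_pos
  have hb := gaussRate_pos he hL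
  set N := L ^ (1 / 4 : ℝ) / (Real.pi ^ (3 / 8 : ℝ) * e ^ (1 / 4 : ℝ)) with hN
  have h : (fun x => gaussian e L x ^ 2)
      = fun x => N ^ 2 * Real.exp (-(gaussRate e L) * x ^ 2) := by
    ext x
    rw [gaussian_eq, mul_pow, ← Real.exp_nat_mul]
    congr 2
    push_cast; ring
  rw [h]
  refine ⟨(integrable_exp_neg_mul_sq hb).const_mul _, ?_⟩
  rw [integral_const_mul, integral_gaussian]
  -- The fourth power removes the exponents `1/4` and leaves `π^{3/2} = π√π` as the only fractional
  -- power of `π` coming from the prefactor.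
  have h4 : N ^ 4 = (Real.pi / gaussRate e L)⁻¹ := by
    rw [hN, div_pow, mul_pow, ← Real.rpow_natCast, ← Real.rpow_natCast, ← Real.rpow_natCast,
      ← Real.rpow_mul hL.le, ← Real.rpow_mul hpi.le, ← Real.rpow_mul he.le]
    norm_num
    have : Real.pi ^ (3 / 2 : ℝ) = Real.pi * √Real.pi := by
      rw [Real.sqrt_eq_rpow, ← Real.rpow_one_add' hpi.le (by norm_num)]; norm_num
    rw [this, gaussRate]
    have : √Real.pi ≠ 0 := by positivity
    field_simp
  have h2 : N ^ 2 = √(Real.pi / gaussRate e L)⁻¹ := by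
    rw [← h4, show N ^ 4 = (N ^ 2) ^ 2 by ring, Real.sqrt_sq (by positivity)]
  rw [h2, Real.sqrt_inv, inv_mul_cancel₀]
  positivity

/-! ### The vacuum -/

theorem vacuum_eq (e L : ℝ) : vacuum e L = latticeSum L (gaussian e L) := rfl

theorem hasDerivAt_vacuum (he : 0 < e) (hL : 0 < L) (a : ℝ) : HasDerivAt (vacuum e L)
    (latticeSum L (fun x => -(gaussRate e L) * x * gaussian e L x) a) a := by
  obtain ⟨C, hC⟩ := exists_decays_gaussian he hL
  obtain ⟨C', hC'⟩ := exists_decays_deriv_gaussian he hL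
  exact hasDerivAt_latticeSum hL hC hC' (hasDerivAt_gaussian e L) a

theorem deriv_vacuum (he : 0 < e) (hL : 0 < L) :
    deriv (vacuum e L) = latticeSum L (fun x => -(gaussRate e L) * x * gaussian e L x) :=
  funext fun a => (hasDerivAt_vacuum he hL a).deriv

theorem hasDerivAt_deriv_vacuum (he : 0 < e) (hL : 0 < L) (a : ℝ) :
    HasDerivAt (deriv (vacuum e L)) (latticeSum L
      (fun x => (gaussRate e L ^ 2 * x ^ 2 - gaussRate e L) * gaussian e L x) a) a := by
  obtain ⟨C, hC⟩ := exists_decays_deriv_gaussian he hL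
  obtain ⟨C', hC'⟩ := exists_decays_deriv_deriv_gaussian he hL
  rw [deriv_vacuum he hL]
  exact hasDerivAt_latticeSum hL hC hC' (hasDerivAt_deriv_gaussian e L) a

theorem deriv_deriv_vacuum (he : 0 < e) (hL : 0 < L) :
    deriv (deriv (vacuum e L)) = latticeSum L
      (fun x => (gaussRate e L ^ 2 * x ^ 2 - gaussRate e L) * gaussian e L x) :=
  funext fun a => (hasDerivAt_deriv_vacuum he hL a).deriv

theorem contDiff_vacuum (he : 0 < e) (hL : 0 < L) : ContDiff ℝ 2 (vacuum e L) := by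
  have h0 : ContDiff ℝ 0 (deriv (deriv (vacuum e L))) := by
    rw [contDiff_zero, deriv_deriv_vacuum he hL]
    obtain ⟨C, hC⟩ := exists_decays_deriv_deriv_gaussian he hL
    obtain ⟨C', hC'⟩ := exists_decays_deriv_deriv_deriv_gaussian he hL
    exact continuous_iff_continuousAt.2 fun a =>
      (hasDerivAt_latticeSum hL hC hC' (hasDerivAt_deriv_deriv_gaussian e L) a).continuousAt
  have h1 : ContDiff ℝ (0 + 1) (deriv (vacuum e L)) := contDiff_succ_iff_deriv.2
    ⟨fun a => (hasDerivAt_deriv_vacuum he hL a).differentiableAt, by simp, h0⟩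
  have h2 : ContDiff ℝ (1 + 1) (vacuum e L) := contDiff_succ_iff_deriv.2
    ⟨fun a => (hasDerivAt_vacuum he hL a).differentiableAt, by simp, by simpa using h1⟩
  exact h2

/-- `2P - (aL/π + 1) = -(L/π)(a - (2π/L)(P - 1/2))`, which explains the centres of the Gaussians. -/
theorem potential_coeff (hL : 0 < L) (a : ℝ) (P : ℤ) :
    Real.pi / (2 * L) * (2 * P - (a * L / Real.pi + 1)) ^ 2
      = L / (2 * Real.pi) * shifted L a P ^ 2 := by
  have hpi := Real.pi_pos
  rw [shifted]
  field_simp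
  ring

theorem toFock_potentialPart_unexcited (hL : 0 < L) (φ : ℝ → ℝ) (a : ℝ) (P : ℤ) :
    ((φ (shifted L a P) : ℝ) : ℂ) • toFock (potentialPart L a (unexcited P))
      = ((L / (2 * Real.pi) * (shifted L a P ^ 2 * φ (shifted L a P)) : ℝ) : ℂ)
        • toFock (unexcited P) := by
  rw [potentialPart_unexcited, map_smul, smul_smul, potential_coeff hL, ← Complex.ofReal_mul]
  congr 2
  ring

/-- The eigenvalue equation solved for the potential term. Since `Ψ₀(a)` is not a finite particle
vector, the operator acts on the terms of the series, whose convergence follows from the decay of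
`x² f(x)`. -/
theorem hasSum_potentialPart_vacuum (he : 0 < e) (hL : 0 < L) (a : ℝ) : HasSum
    (fun P : ℤ => vacuumCoeff e L P a • toFock (potentialPart L a (unexcited P)))
    (((e ^ 2 / (2 * L) : ℝ) : ℂ) • deriv (deriv (vacuum e L)) a
      + (groundEnergy e : ℂ) • vacuum e L a) := by
  obtain ⟨C, hC⟩ := exists_decays_gaussian he hL
  obtain ⟨C₂, hC₂⟩ := exists_decays_deriv_deriv_gaussian he hL
  obtain ⟨D, hD⟩ := exists_decays_sq_gaussian he hL
  have h := (hD.const_mul (L / (2 * Real.pi))).hasSum hL a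
  have h1 : latticeSum L (fun x => L / (2 * Real.pi) * (x ^ 2 * gaussian e L x)) a
      = ((e ^ 2 / (2 * L) : ℝ) : ℂ) • deriv (deriv (vacuum e L)) a
      + (groundEnergy e : ℂ) • vacuum e L a := by
    simp_rw [oscillator_gaussian he hL]
    rw [latticeSum_add hL (hC₂.const_mul _) (hC.const_mul _), latticeSum_const_mul,
      latticeSum_const_mul, deriv_deriv_vacuum he hL, vacuum_eq]
  rw [← h1]
  refine h.congr_fun fun P => ?_
  exact toFock_potentialPart_unexcited hL (gaussian e L) a P

/-! ### Compactly supported profiles give elements of the domain -/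

variable {g : ℝ → ℝ}

theorem exists_decays_of_hasCompactSupport (hc : Continuous g) (hs : HasCompactSupport g) :
    ∃ C, Decays g C := by
  obtain ⟨C, hC⟩ := (by fun_prop : Continuous fun x => g x * (1 + x ^ 2)).bounded_above_of_compact_support
    hs.mul_right
  refine ⟨C, fun x => ?_⟩
  have h := hC x
  rw [Real.norm_eq_abs, abs_mul, abs_of_nonneg (by positivity : 0 ≤ 1 + x ^ 2)] at h
  rwa [le_div_iff₀ (by positivity)]

theorem hasDerivAt_latticeSum_of_hasCompactSupport (hL : 0 < L) (hg : ContDiff ℝ ∞ g)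
    (hs : HasCompactSupport g) (a : ℝ) :
    HasDerivAt (latticeSum L g) (latticeSum L (deriv g) a) a := by
  obtain ⟨C, hC⟩ := exists_decays_of_hasCompactSupport hg.continuous hs
  obtain ⟨C', hC'⟩ := exists_decays_of_hasCompactSupport (hg.continuous_deriv (by simp)) hs.deriv
  exact hasDerivAt_latticeSum hL hC hC'
    (fun x => (hg.differentiable (by simp) x).hasDerivAt) a

theorem deriv_latticeSum (hL : 0 < L) (hg : ContDiff ℝ ∞ g) (hs : HasCompactSupport g) :
    deriv (latticeSum L g) = latticeSum L (deriv g) :=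
  funext fun a => (hasDerivAt_latticeSum_of_hasCompactSupport hL hg hs a).deriv

/-- Smooth compactly supported profiles are stable under differentiation, so induction over all of
them applies. -/
theorem contDiff_latticeSum (hL : 0 < L) (hg : ContDiff ℝ ∞ g) (hs : HasCompactSupport g) :
    ContDiff ℝ ∞ (latticeSum L g) := by
  refine contDiff_infty.2 fun n => ?_
  induction n generalizing g with
  | zero =>
    rw [Nat.cast_zero, contDiff_zero]
    exact continuous_iff_continuousAt.2 fun a =>
      (hasDerivAt_latticeSum_of_hasCompactSupport hL hg hs a).continuousAt
  | succ n ih =>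
    rw [Nat.cast_succ, contDiff_succ_iff_deriv]
    refine ⟨fun a => (hasDerivAt_latticeSum_of_hasCompactSupport hL hg hs a).differentiableAt,
      by simp, ?_⟩
    rw [deriv_latticeSum hL hg hs]
    exact ih (contDiff_infty_iff_deriv.1 hg).2 hs.deriv

theorem exists_finset_shifted (hL : 0 < L) (hs : HasCompactSupport g) (a : ℝ) :
    ∃ F : Finset ℤ, ∀ P ∉ F, g (shifted L a P) = 0 := by
  have hl := period_pos hL
  obtain ⟨R, hR⟩ := hs.isCompact.isBounded.subset_closedBall (0 : ℝ)
  -- A nonzero term requires `(2π/L)|P - 1/2| ≤ |a| + R`; the added 1 absorbs the offset `1/2`.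
  set B : ℝ := (|a| + R) / (2 * Real.pi / L) + 1 with hB
  refine ⟨Finset.Icc (-⌈B⌉) ⌈B⌉, fun P hP => ?_⟩
  by_contra h0
  refine hP ?_
  have h1 := hR (subset_tsupport g h0)
  rw [mem_closedBall_zero_iff, Real.norm_eq_abs, shifted] at h1
  have h2 : 2 * Real.pi / L * |(P : ℝ) - 1 / 2| ≤ |a| + R := by
    have h5 : 2 * Real.pi / L * |(P : ℝ) - 1 / 2| = |2 * Real.pi / L * ((P : ℝ) - 1 / 2)| := by
      rw [abs_mul, abs_of_pos hl]
    rw [h5]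
    have := abs_sub_abs_le_abs_sub (2 * Real.pi / L * ((P : ℝ) - 1 / 2)) a
    rw [abs_sub_comm] at this
    linarith
  have h3 : |(P : ℝ) - 1 / 2| ≤ (|a| + R) / (2 * Real.pi / L) := by
    rw [le_div_iff₀ hl]; linarith
  rw [abs_le] at h3
  have h4 := Int.le_ceil B
  rw [Finset.mem_Icc]
  constructor
  · have : (-(⌈B⌉ : ℤ) : ℝ) ≤ P := by linarith
    exact_mod_cast this
  · have : (P : ℝ) ≤ ⌈B⌉ := by linarith
    exact_mod_cast this

/-- `∑_P g(a - (2π/L)(P - 1/2)) Ω_P` as a finite particle vector, for compactly supported `g`. -/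
def latticeVec (L : ℝ) (g : ℝ → ℝ) (a : ℝ) : AlgFock :=
  ∑ᶠ P : ℤ, ((g (shifted L a P) : ℝ) : ℂ) • unexcited P

theorem exists_latticeVec_eq (hL : 0 < L) (hs : HasCompactSupport g) (a : ℝ) :
    ∃ F : Finset ℤ, (∀ P ∉ F, g (shifted L a P) = 0) ∧
      latticeVec L g a = ∑ P ∈ F, ((g (shifted L a P) : ℝ) : ℂ) • unexcited P := by
  obtain ⟨F, hF⟩ := exists_finset_shifted hL hs a
  refine ⟨F, hF, finsum_eq_sum_of_support_subset _ fun P hP => ?_⟩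
  by_contra h
  exact hP (by simp [hF P h])

theorem toFock_latticeVec (hL : 0 < L) (hs : HasCompactSupport g) (a : ℝ) :
    toFock (latticeVec L g a) = latticeSum L g a := by
  obtain ⟨F, hF, h⟩ := exists_latticeVec_eq hL hs a
  rw [h, latticeSum, tsum_eq_sum (s := F) fun P hP => by rw [hF P hP]; simp, map_sum]
  simp only [map_smul]

theorem toFock_potentialPart_latticeVec (hL : 0 < L) (hs : HasCompactSupport g) (a : ℝ) :
    toFock (potentialPart L a (latticeVec L g a))
      = latticeSum L (fun x => L / (2 * Real.pi) * (x ^ 2 * g x)) a := by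
  obtain ⟨F, hF, h⟩ := exists_latticeVec_eq hL hs a
  rw [h, latticeSum, tsum_eq_sum (s := F) fun P hP => by rw [hF P hP]; simp, map_sum, map_sum]
  refine Finset.sum_congr rfl fun P _ => ?_
  rw [map_smul, map_smul, toFock_potentialPart_unexcited hL]

theorem isInDomain_latticeVec (hL : 0 < L) (hg : ContDiff ℝ ∞ g) (hs : HasCompactSupport g) :
    IsInDomain L (latticeVec L g) := by
  refine ⟨fun a => ?_, ?_, fun a => ?_⟩
  · obtain ⟨F, -, h⟩ := exists_latticeVec_eq hL hs a
    rw [h]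
    exact Submodule.sum_mem _ fun P _ => Submodule.smul_mem _ _ (unexcited_mem_zeroCharge P)
  · rw [funext (toFock_latticeVec hL hs)]
    exact contDiff_latticeSum hL hg hs
  · rw [toFock_latticeVec hL hs, toFock_latticeVec hL hs, latticeSum_twisted]

/-- The one-variable oscillator `-(e²/2L) d²/dx² + (L/2π) x²`. -/
def oscillator (e L : ℝ) (g : ℝ → ℝ) (x : ℝ) : ℝ :=
  -(e ^ 2 / (2 * L)) * deriv (deriv g) x + L / (2 * Real.pi) * (x ^ 2 * g x)

theorem contDiff_oscillator (e L : ℝ) (hg : ContDiff ℝ ∞ g) : ContDiff ℝ ∞ (oscillator e L g) := by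
  have h2 : ContDiff ℝ ∞ (deriv (deriv g)) :=
    (contDiff_infty_iff_deriv.1 (contDiff_infty_iff_deriv.1 hg).2).2
  unfold oscillator
  fun_prop

theorem hasCompactSupport_oscillator (e L : ℝ) (hs : HasCompactSupport g) :
    HasCompactSupport (oscillator e L g) :=
  (hs.deriv.deriv.mul_left (f := fun _ => -(e ^ 2 / (2 * L)))).add
    ((hs.mul_left (f := fun x => x ^ 2)).mul_left (f := fun _ => L / (2 * Real.pi)))

theorem latticeSum_oscillator (hL : 0 < L) (hg : ContDiff ℝ ∞ g) (hs : HasCompactSupport g)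
    (a : ℝ) : latticeSum L (oscillator e L g) a
      = ((-(e ^ 2 / (2 * L)) : ℝ) : ℂ) • latticeSum L (deriv (deriv g)) a
        + latticeSum L (fun x => L / (2 * Real.pi) * (x ^ 2 * g x)) a := by
  have hg'' := (contDiff_infty_iff_deriv.1 (contDiff_infty_iff_deriv.1 hg).2).2
  obtain ⟨C, hC⟩ := exists_decays_of_hasCompactSupport hg''.continuous hs.deriv.deriv
  have hs2 : HasCompactSupport fun x => x ^ 2 * g x := hs.mul_left (f := fun x => x ^ 2)
  have hc2 : Continuous fun x => x ^ 2 * g x := by have := hg.continuous; fun_prop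
  obtain ⟨D, hD⟩ := exists_decays_of_hasCompactSupport hc2 hs2
  rw [← latticeSum_const_mul]
  exact latticeSum_add hL (hC.const_mul (-(e ^ 2 / (2 * L)))) (hD.const_mul (L / (2 * Real.pi))) a

/-- In the variable `x` the potential on `Ω_P` is the same for every `P`, so `H₀` acts on the
profile as one oscillator on the line. -/
theorem hamiltonian_latticeVec (hL : 0 < L) (hg : ContDiff ℝ ∞ g) (hs : HasCompactSupport g)
    (a : ℝ) : hamiltonian e L (latticeVec L g) a = latticeSum L (oscillator e L g) a := by
  have h1 : (fun a => toFock (latticeVec L g a)) = latticeSum L g :=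
    funext (toFock_latticeVec hL hs)
  have hg' := (contDiff_infty_iff_deriv.1 hg).2
  rw [latticeSum_oscillator hL hg hs, hamiltonian, toFock_potentialPart_latticeVec hL hs, h1,
    deriv_latticeSum hL hg hs, deriv_latticeSum hL hg' hs.deriv, Complex.ofReal_neg]

theorem continuous_latticeSum (hL : 0 < L) (hg : ContDiff ℝ ∞ g) (hs : HasCompactSupport g) :
    Continuous (latticeSum L g) := (contDiff_latticeSum hL hg hs).continuous

theorem mem_hamiltonianGraph_latticeVec (e : ℝ) (hL : 0 < L) (hg : ContDiff ℝ ∞ g)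
    (hs : HasCompactSupport g) :
    ((memLp_circleMeasure (continuous_latticeSum hL hg hs) L).toLp (latticeSum L g),
      (memLp_circleMeasure (continuous_latticeSum hL (contDiff_oscillator e L hg)
        (hasCompactSupport_oscillator e L hs)) L).toLp (latticeSum L (oscillator e L g)))
      ∈ hamiltonianGraph e L := by
  refine ⟨latticeVec L g, isInDomain_latticeVec hL hg hs, ?_, ?_⟩
  · rw [funext (toFock_latticeVec hL hs)]
    exact MemLp.coeFn_toLp (memLp_circleMeasure (continuous_latticeSum hL hg hs) L)
  · rw [funext (hamiltonian_latticeVec hL hg hs)]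
    exact MemLp.coeFn_toLp (memLp_circleMeasure (continuous_latticeSum hL
      (contDiff_oscillator e L hg) (hasCompactSupport_oscillator e L hs)) L)

/-! ### Approximation of the vacuum in the graph norm -/

/-- A smooth cutoff function. -/
def cutoff : ContDiffBump (0 : ℝ) := ⟨1, 2, one_pos, one_lt_two⟩

/-- The Gaussian cut off at distance of order `1 / ε`. -/
def cutGaussian (e L ε x : ℝ) : ℝ := gaussian e L x * cutoff (ε * x)

theorem contDiff_cutoff : ContDiff ℝ ∞ cutoff := cutoff.contDiff

theorem contDiff_cutGaussian (e L ε : ℝ) : ContDiff ℝ ∞ (cutGaussian e L ε) :=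
  (contDiff_gaussian e L).mul (contDiff_cutoff.comp (contDiff_const.mul contDiff_id))

theorem hasCompactSupport_cutGaussian (e L : ℝ) {ε : ℝ} (hε : 0 < ε) :
    HasCompactSupport (cutGaussian e L ε) := by
  refine HasCompactSupport.mul_left (f := gaussian e L) (f' := fun x => cutoff (ε * x)) ?_
  exact cutoff.hasCompactSupport.comp_homeomorph (Homeomorph.mulLeft₀ ε hε.ne')

/-- The difference is zero for `|y| ≤ 1` and at most 1 elsewhere. At `y = εx` the quadratic bound
converts the truncation error into powers of `ε`, with the factor `x²` absorbed by the Gaussian. -/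
theorem abs_one_sub_cutoff_le (y : ℝ) : |cutoff y - 1| ≤ y ^ 2 := by
  rcases le_or_gt |y| 1 with h | h
  · rw [cutoff.one_of_mem_closedBall (by simpa [cutoff] using h)]
    simpa using sq_nonneg y
  · have h1 : (1 : ℝ) ≤ y ^ 2 := by rw [← sq_abs]; nlinarith
    have h2 := cutoff.nonneg (x := y)
    have h3 := cutoff.le_one (x := y)
    rw [abs_le]; constructor <;> linarith

theorem exists_deriv_cutoff_le : ∃ K, 0 ≤ K ∧ (∀ y, |deriv cutoff y| ≤ K) ∧
    ∀ y, |deriv (deriv cutoff) y| ≤ K := by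
  have h1 := (contDiff_infty_iff_deriv.1 contDiff_cutoff).2
  have h2 := (contDiff_infty_iff_deriv.1 h1).2
  obtain ⟨K, hK⟩ := h1.continuous.bounded_above_of_compact_support cutoff.hasCompactSupport.deriv
  obtain ⟨K', hK'⟩ :=
    h2.continuous.bounded_above_of_compact_support cutoff.hasCompactSupport.deriv.deriv
  exact ⟨max K K', ((norm_nonneg _).trans (hK 0)).trans (le_max_left _ _),
    fun y => (hK y).trans (le_max_left _ _), fun y => (hK' y).trans (le_max_right _ _)⟩

theorem hasDerivAt_cutoff_mul (ε x : ℝ) :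
    HasDerivAt (fun x => cutoff (ε * x)) (ε * deriv cutoff (ε * x)) x := by
  have h := ((contDiff_cutoff.differentiable (by simp) (ε * x)).hasDerivAt).comp x
    ((hasDerivAt_id x).const_mul ε)
  exact h.congr_deriv (by simp [mul_comm])

theorem hasDerivAt_deriv_cutoff_mul (ε x : ℝ) :
    HasDerivAt (fun x => ε * deriv cutoff (ε * x)) (ε ^ 2 * deriv (deriv cutoff) (ε * x)) x := by
  have h1 := (contDiff_infty_iff_deriv.1 contDiff_cutoff).2
  have h := (((h1.differentiable (by simp) (ε * x)).hasDerivAt).comp x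
    ((hasDerivAt_id x).const_mul ε)).const_mul ε
  exact h.congr_deriv (by simp; ring)

theorem deriv_deriv_cutGaussian (e L ε x : ℝ) : deriv (deriv (cutGaussian e L ε)) x
    = (gaussRate e L ^ 2 * x ^ 2 - gaussRate e L) * gaussian e L x * cutoff (ε * x)
      + 2 * (-(gaussRate e L) * x * gaussian e L x) * (ε * deriv cutoff (ε * x))
      + gaussian e L x * (ε ^ 2 * deriv (deriv cutoff) (ε * x)) := by
  have h1 : deriv (cutGaussian e L ε) = fun x => -(gaussRate e L) * x * gaussian e L x
      * cutoff (ε * x) + gaussian e L x * (ε * deriv cutoff (ε * x)) := funext fun x =>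
    ((hasDerivAt_gaussian e L x).mul (hasDerivAt_cutoff_mul ε x)).deriv
  rw [h1]
  have h2 := ((hasDerivAt_deriv_gaussian e L x).mul (hasDerivAt_cutoff_mul ε x)).add
    ((hasDerivAt_gaussian e L x).mul (hasDerivAt_deriv_cutoff_mul ε x))
  refine h2.deriv.trans ?_
  ring

/-- The error is at most `(εx)² f(x)`; one of the two factors `ε` suffices, the other being bounded
by 1. -/
theorem exists_decays_cutGaussian_sub (he : 0 < e) (hL : 0 < L) : ∃ C, ∀ ε, 0 < ε → ε ≤ 1 →
    Decays (fun x => cutGaussian e L ε x + (-1) * gaussian e L x) (ε * C) := by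
  obtain ⟨D, hD⟩ := exists_decays_sq_gaussian he hL
  refine ⟨D, fun ε hε hε1 x => ?_⟩
  have h := hD x
  have hg := gaussian_nonneg he hL x
  rw [abs_of_nonneg (mul_nonneg (sq_nonneg x) hg)] at h
  have h1 : cutGaussian e L ε x + (-1) * gaussian e L x
      = gaussian e L x * (cutoff (ε * x) - 1) := by rw [cutGaussian]; ring
  simp only [h1]
  rw [abs_mul, abs_of_nonneg hg, mul_div_assoc]
  calc gaussian e L x * |cutoff (ε * x) - 1| ≤ gaussian e L x * (ε * x) ^ 2 :=
        mul_le_mul_of_nonneg_left (abs_one_sub_cutoff_le _) hg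
    _ = ε * (ε * (x ^ 2 * gaussian e L x)) := by ring
    _ ≤ ε * (1 * (x ^ 2 * gaussian e L x)) := by gcongr
    _ ≤ ε * (D / (1 + x ^ 2)) := by rw [one_mul]; gcongr

/-- The Gaussian is an eigenfunction, so besides `E₀` times the truncation error only the commutator
with the cutoff remains. Its terms contain `ε χ'` or `ε² χ''` and are `O(ε)` with the decay of `f'`
and `f`. -/
theorem exists_decays_oscillator_cutGaussian_sub (he : 0 < e) (hL : 0 < L) :
    ∃ C, ∀ ε, 0 < ε → ε ≤ 1 → Decays (fun x => oscillator e L (cutGaussian e L ε) x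
      + (-(groundEnergy e)) * gaussian e L x) (ε * C) := by
  obtain ⟨A, hA⟩ := exists_decays_gaussian he hL
  obtain ⟨B, hB⟩ := exists_decays_deriv_gaussian he hL
  obtain ⟨D, hD⟩ := exists_decays_cutGaussian_sub he hL
  obtain ⟨K, hK, hK1, hK2⟩ := exists_deriv_cutoff_le
  set α := e ^ 2 / (2 * L) with hα
  have hα0 : 0 ≤ α := by positivity
  have hE : 0 ≤ groundEnergy e := by have := Real.pi_pos; unfold groundEnergy; positivity
  refine ⟨groundEnergy e * D + 2 * α * K * B + α * K * A, fun ε hε hε1 x => ?_⟩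
  have key : oscillator e L (cutGaussian e L ε) x + (-(groundEnergy e)) * gaussian e L x
      = groundEnergy e * (cutGaussian e L ε x + (-1) * gaussian e L x)
        + (-(2 * α * ε)) * deriv cutoff (ε * x) * (-(gaussRate e L) * x * gaussian e L x)
        + (-(α * ε ^ 2)) * deriv (deriv cutoff) (ε * x) * gaussian e L x := by
    have h := oscillator_gaussian he hL x
    rw [oscillator, deriv_deriv_cutGaussian, cutGaussian]
    linear_combination cutoff (ε * x) * h
  have hεε : ε ^ 2 ≤ ε := by nlinarith
  have hx : (0 : ℝ) < 1 + x ^ 2 := by positivity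
  have t1 : |groundEnergy e * (cutGaussian e L ε x + (-1) * gaussian e L x)|
      ≤ groundEnergy e * (ε * D / (1 + x ^ 2)) := by
    rw [abs_mul, abs_of_nonneg hE]; exact mul_le_mul_of_nonneg_left (hD ε hε hε1 x) hE
  have t2 : |(-(2 * α * ε)) * deriv cutoff (ε * x) * (-(gaussRate e L) * x * gaussian e L x)|
      ≤ 2 * α * ε * K * (B / (1 + x ^ 2)) := by
    rw [abs_mul, abs_mul, abs_neg, abs_of_nonneg (by positivity : 0 ≤ 2 * α * ε)]
    exact mul_le_mul (mul_le_mul_of_nonneg_left (hK1 _) (by positivity)) (hB x) (abs_nonneg _)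
      (by positivity)
  have t3 : |(-(α * ε ^ 2)) * deriv (deriv cutoff) (ε * x) * gaussian e L x|
      ≤ α * ε * K * (A / (1 + x ^ 2)) := by
    rw [abs_mul, abs_mul, abs_neg, abs_of_nonneg (by positivity : 0 ≤ α * ε ^ 2)]
    exact mul_le_mul (mul_le_mul (by gcongr) (hK2 _) (abs_nonneg _) (by positivity)) (hA x)
      (abs_nonneg _) (by positivity)
  simp only [key]
  refine (abs_add_three _ _ _).trans ((add_le_add (add_le_add t1 t2) t3).trans_eq ?_)
  ring

/-- The `𝓚`-norm distance of two lattice sums with close profiles. -/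
theorem exists_norm_toLp_sub_le (hL : 0 < L) : ∃ K, 0 ≤ K ∧
    ∀ (φ ψ : ℝ → ℝ) (hφ : Continuous (latticeSum L φ)) (hψ : Continuous (latticeSum L ψ))
      (c A B C : ℝ), Decays φ A → Decays ψ B → Decays (fun x => φ x + (-c) * ψ x) C →
      ‖(memLp_circleMeasure hφ L).toLp (latticeSum L φ)
        - (c : ℂ) • (memLp_circleMeasure hψ L).toLp (latticeSum L ψ)‖ ≤ C * K := by
  obtain ⟨K, hK, hle⟩ := exists_norm_latticeSum_le hL
  -- A uniform bound over one period is turned into an `L²` bound by the square root of the length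
  -- of the period.
  refine ⟨K * (measureUnivNNReal (circleMeasure L) : ℝ) ^ (2 : ENNReal).toReal⁻¹, by positivity, ?_⟩
  intro φ ψ hφ hψ c A B C hA hB hC
  refine (Lp.norm_le_of_ae_bound (mul_nonneg hC.nonneg hK) ?_).trans_eq (by ring)
  have h1 := (memLp_circleMeasure hφ L).coeFn_toLp
  have h2 := (memLp_circleMeasure hψ L).coeFn_toLp
  have h3 := Lp.coeFn_sub ((memLp_circleMeasure hφ L).toLp (latticeSum L φ))
    ((c : ℂ) • (memLp_circleMeasure hψ L).toLp (latticeSum L ψ))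
  have h4 := Lp.coeFn_smul (c : ℂ) ((memLp_circleMeasure hψ L).toLp (latticeSum L ψ))
  filter_upwards [h1, h2, h3, h4, ae_circleMeasure (hle _ _ hC)] with a e1 e2 e3 e4 e5
  rw [e3, Pi.sub_apply, e4, Pi.smul_apply, e1, e2]
  rw [latticeSum_add hL hA (hB.const_mul (-c)), latticeSum_const_mul] at e5
  rwa [Complex.ofReal_neg, neg_smul, ← sub_eq_add_neg] at e5

/-! ### The vacuum as a unit vector and the closure of `H₀` -/

theorem continuous_vacuum (he : 0 < e) (hL : 0 < L) : Continuous (vacuum e L) :=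
  (contDiff_vacuum he hL).continuous

/-- The vacuum as an element of `𝓚`. -/
def vacuumLp (he : 0 < e) (hL : 0 < L) : StateSpace L :=
  (memLp_circleMeasure (continuous_vacuum he hL) L).toLp (vacuum e L)

/-- Parseval in `P` and unfolding in `a` turn the norm over a period into `∫ f² = 1` over the line.
-/
theorem norm_vacuumLp (he : 0 < e) (hL : 0 < L) : ‖vacuumLp he hL‖ = 1 := by
  obtain ⟨C, hC⟩ := exists_decays_gaussian he hL
  have h := norm_toLp_sq (continuous_vacuum he hL) L
  obtain ⟨hi, h1⟩ := integral_gaussian_sq he hL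
  change ‖vacuumLp he hL‖ ^ 2
    = (∫⁻ a, ENNReal.ofReal (‖latticeSum L (gaussian e L) a‖ ^ 2) ∂circleMeasure L).toReal at h
  rw [hC.lintegral_norm_sq (contDiff_gaussian e L).continuous hL,
    ← ofReal_integral_eq_lintegral_ofReal hi (ae_of_all _ fun x => sq_nonneg _), h1] at h
  have h2 : ‖vacuumLp he hL‖ ^ 2 = 1 := by simpa using h
  exact (pow_eq_one_iff_of_nonneg (norm_nonneg _) two_ne_zero).1 h2

/-- The cut-off Gaussians with `ε = 1/(n+1)` give points of the graph; both components converge at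
rate `O(ε)` by the two decay estimates. -/
theorem vacuumLp_mem_closure (he : 0 < e) (hL : 0 < L) :
    (vacuumLp he hL, (groundEnergy e : ℂ) • vacuumLp he hL)
      ∈ closure (hamiltonianGraph e L) := by
  obtain ⟨A, hA⟩ := exists_decays_gaussian he hL
  obtain ⟨C₁, hC₁⟩ := exists_decays_cutGaussian_sub he hL
  obtain ⟨C₂, hC₂⟩ := exists_decays_oscillator_cutGaussian_sub he hL
  obtain ⟨K, hK, hle⟩ := exists_norm_toLp_sub_le hL
  have hcd := contDiff_cutGaussian e L
  have hcs : ∀ n : ℕ, HasCompactSupport (cutGaussian e L (1 / ((n : ℝ) + 1))) := fun n =>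
    hasCompactSupport_cutGaussian e L (by positivity)
  rw [mem_closure_iff_seq_limit]
  refine ⟨fun n => _, fun n => mem_hamiltonianGraph_latticeVec e hL (hcd _) (hcs n), ?_⟩
  have hε : ∀ n : ℕ, 0 < 1 / ((n : ℝ) + 1) ∧ 1 / ((n : ℝ) + 1) ≤ 1 := fun n =>
    ⟨by positivity, by rw [div_le_one (by positivity)]; linarith [n.cast_nonneg (α := ℝ)]⟩
  have hlim : ∀ C : ℝ, Filter.Tendsto (fun n : ℕ => 1 / ((n : ℝ) + 1) * C * K) Filter.atTop
      (nhds 0) := fun C => by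
    simpa using (tendsto_one_div_add_atTop_nhds_zero_nat.mul_const C).mul_const K
  refine Filter.Tendsto.prodMk_nhds ?_ ?_
  · refine tendsto_iff_norm_sub_tendsto_zero.2 (squeeze_zero (fun _ => norm_nonneg _) (fun n => ?_)
      (hlim C₁))
    obtain ⟨B, hB⟩ := exists_decays_of_hasCompactSupport (hcd (1 / ((n : ℝ) + 1))).continuous (hcs n)
    have := hle _ _ (continuous_latticeSum hL (hcd _) (hcs n)) (continuous_vacuum he hL) 1 B A _ hB
      hA (hC₁ _ (hε n).1 (hε n).2)
    rwa [Complex.ofReal_one, one_smul] at this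
  · refine tendsto_iff_norm_sub_tendsto_zero.2 (squeeze_zero (fun _ => norm_nonneg _) (fun n => ?_)
      (hlim C₂))
    have hod := contDiff_oscillator e L (hcd (1 / ((n : ℝ) + 1)))
    have hos := hasCompactSupport_oscillator e L (hcs n)
    obtain ⟨B, hB⟩ := exists_decays_of_hasCompactSupport hod.continuous hos
    exact hle _ _ (continuous_latticeSum hL hod hos) (continuous_vacuum he hL) (groundEnergy e) B A _
      hB hA (hC₂ _ (hε n).1 (hε n).2)

end

end Schwinger

end

theorem mainTheorem2 (e L : ℝ) (he : 0 < e) (hL : 0 < L) :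
    -- `⟨Ψ, H₀Ψ⟩ ≥ E₀ ‖Ψ‖²` for every `Ψ ∈ 𝓓`, the left side being an integral with integrable
    -- negative part, hence well defined in `(-∞, ∞]`
    (∀ Ψ : ℝ → Schwinger.AlgFock, Schwinger.IsInDomain L Ψ →
      (∫⁻ a, ENNReal.ofReal
          (-(inner ℂ (Schwinger.toFock (Ψ a)) (Schwinger.hamiltonian e L Ψ a)).re)
          ∂Schwinger.circleMeasure L) < ⊤ ∧
      ENNReal.ofReal (Schwinger.groundEnergy e *
          ∫ a, ‖Schwinger.toFock (Ψ a)‖ ^ 2 ∂Schwinger.circleMeasure L)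
        + (∫⁻ a, ENNReal.ofReal
            (-(inner ℂ (Schwinger.toFock (Ψ a)) (Schwinger.hamiltonian e L Ψ a)).re)
            ∂Schwinger.circleMeasure L)
        ≤ ∫⁻ a, ENNReal.ofReal
            (inner ℂ (Schwinger.toFock (Ψ a)) (Schwinger.hamiltonian e L Ψ a)).re
            ∂Schwinger.circleMeasure L) ∧
    -- `H₀ ≥ E₀` as an operator in the Hilbert space
    (∀ p ∈ Schwinger.hamiltonianGraph e L,
      (inner ℂ p.1 p.2).im = 0 ∧
      Schwinger.groundEnergy e * ‖p.1‖ ^ 2 ≤ (inner ℂ p.1 p.2).re) ∧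
    -- the series defining `Ψ₀` converges, in the zero charge space
    (∀ a, Summable fun P : ℤ =>
      Schwinger.vacuumCoeff e L P a • Schwinger.toFock (Schwinger.unexcited P)) ∧
    (∀ a, Schwinger.vacuum e L a ∈ Schwinger.zeroChargeFock) ∧
    -- twisted periodicity of `Ψ₀` and of `Ψ₀'`
    ContDiff ℝ 2 (Schwinger.vacuum e L) ∧
    (∀ a, Schwinger.vacuum e L (a + 2 * Real.pi / L)
      = Schwinger.gauge.symm (Schwinger.vacuum e L a)) ∧
    (∀ a, deriv (Schwinger.vacuum e L) (a + 2 * Real.pi / L)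
      = Schwinger.gauge.symm (deriv (Schwinger.vacuum e L) a)) ∧
    -- `-(e²/2L) Ψ₀'' + ((π/2L) (Q^{5,reg})² + T) Ψ₀ = E₀ Ψ₀` at every `a`
    (∀ a, HasSum
      (fun P : ℤ => Schwinger.vacuumCoeff e L P a •
        Schwinger.toFock (Schwinger.potentialPart L a (Schwinger.unexcited P)))
      (((e ^ 2 / (2 * L) : ℝ) : ℂ) • deriv (deriv (Schwinger.vacuum e L)) a
        + (Schwinger.groundEnergy e : ℂ) • Schwinger.vacuum e L a)) ∧
    -- `Ψ₀` is a unit vector in the domain of the closure of `H₀`, with `H₀ Ψ₀ = E₀ Ψ₀`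
    (∃ ψ₀ : Schwinger.StateSpace L,
      (ψ₀ =ᵐ[Schwinger.circleMeasure L] Schwinger.vacuum e L) ∧
      ‖ψ₀‖ = 1 ∧
      (ψ₀, (Schwinger.groundEnergy e : ℂ) • ψ₀) ∈ closure (Schwinger.hamiltonianGraph e L)) := by
  obtain ⟨C, hC⟩ := Schwinger.exists_decays_gaussian he hL
  refine ⟨fun Ψ hΨ => Schwinger.groundEnergy_le_lintegral he hL hΨ,
    fun p hp => Schwinger.groundEnergy_le_of_mem_graph he hL hp, fun a => hC.summable hL a,
    fun a => hC.latticeSum_mem hL a, Schwinger.contDiff_vacuum he hL,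
    fun a => Schwinger.latticeSum_twisted L _ a, fun a => ?_,
    fun a => Schwinger.hasSum_potentialPart_vacuum he hL a,
    Schwinger.vacuumLp he hL, MeasureTheory.MemLp.coeFn_toLp _, Schwinger.norm_vacuumLp he hL,
    Schwinger.vacuumLp_mem_closure he hL⟩
  rw [Schwinger.deriv_vacuum he hL]
  exact Schwinger.latticeSum_twisted L _ a
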